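/- **Setting.** Let $\{\nu_a : a\in J\}$ be a nondegenerate one-parameter exponential family on $\mathbb R$ (densities proportional to $e^{\theta x}$ with respect to a reference measure that is not concentrated at one point, $\theta$ in an open interval on which these functions are integrable), parameterized by its means $a\in J$; examples are the Bernoulli and the Poisson distributions. Let $d(a,b)$ be the Kullback–Leibler divergence of $\nu_a$ from $\nu_b$, and $d_B$ that of Bernoulli distributions. Fix $K\ge1$ and a threshold $\gamma\in J$. Slice $k\in\{1,\dots,K\}$ has load $\mu_k\in J$; the measurements $X_k(t)$, $t\ge1$, of slice $k$ are i.i.d. with law $\nu_{\mu_k}$, independently over slices. Slice $k$ is available if $\mu_k<\gamma$; if some slice is available, let $k^\star\in\arg\max_{k:\mu_k<\gamma}\mu_k$ and $\mu^\star=\mu_{k^\star}$. Let $\mathcal M$ be the set of $\mu\in J^K$ such that $\mu_k\ne\gamma$ for all $k$ and $k^\star$ is unique whenever some slice is available. For the packing-slice criterion the set of correct answers is $\mathcal C(\mu)=\{k^\star\}$ if some slice is available, and $\mathcal C(\mu)=\{0\}$ otherwise. An algorithm measures in each slot $t$ one slice $k_t$ that is $\mathcal F_{t-1}$-measurable, where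 $\mathcal F_t=\sigma(k_1,X_{k_1}(1),\dots,k_t,X_{k_t}(t))$, stops at a stopping time $\tau$ of $(\mathcal F_t)$ and returns an $\mathcal F_\tau$-measurable $\hat k\in\{0,\dots,K\}$. It is $\delta$-PC if $\mathbb P_\mu[\tau<\infty]=1$ and $\mathbb P_\mu[\hat k\notin\mathcal C(\mu)]\le\delta$ for every $\mu\in\mathcal M$. For $x\ge0$ let $$g_{j,k}(x)=d\Big(\mu_k,\tfrac{\mu_k+x\mu_j}{1+x}\Big)+x\,d\Big(\mu_j,\tfrac{\mu_k+x\mu_j}{1+x}\Big),$$ let $x_{j,k}=g_{j,k}^{-1}$, defined on $g_{j,k}([0,\infty))$, with the convention $x_{k,k}\equiv1$, and for a set $S$ of slices let $$F_k(y;S)=\sum_{j\in S}\frac{d\big(\mu_k,(\mu_k+x_{j,k}(y)\mu_j)/(1+x_{j,k}(y))\big)}{d\big(\mu_j,(\mu_k+x_{j,k}(y)\mu_j)/(1+x_{j,k}(y))\big)} .$$ **Proposition 3 (packing slice).** Let $\mu\in\mathcal M$ have an available slice, and let $\mathcal S_P=\{j:\mu_j<\mu^\star\}$. 1. If $\mathcal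 S_P\neq\emptyset$, the equation $F_{k^\star}(y;\mathcal S_P)=1$ has exactly one solution $y^\star$ in the common domain of the functions $x_{j,k^\star}$, $j\in\mathcal S_P$; if $\mathcal S_P=\emptyset$, set $y^\star=\infty$. The number $z^\star=\min(d(\mu^\star,\gamma),y^\star)$ is positive and lies in the domain of $x_{j,k^\star}$ for every $j\in\mathcal S_P$. 2. For every $0<\delta\le\frac12$, every $\delta$-PC algorithm satisfies $\mathbb E_\mu[\tau]\ge T_2(\mu)\,d_B(\delta,1-\delta)$, where $$T_2(\mu)=\sum_{k:\mu_k>\mu^\star}d(\mu_k,\gamma)^{-1}+\frac1{z^\star}\sum_{k:\mu_k<\gamma}x_{k,k^\star}(z^\star).$$ 3. The optimal measurement proportions are $$w^\star_k(\mu)=\frac1{T_2(\mu)}\left(\frac{x_{k,k^\star}(z^\star)\mathbf 1_{(\mu_k<\gamma)}}{z^\star}+\frac{\mathbf 1_{(\mu_k>\gamma)}}{d(\mu_k,\gamma)}\right),\qquad k=1,\dots,K;$$ that is, $w^\star(\mu)$ is the unique maximizer of $$w\mapsto\inf_{\lambda\in\mathcal M:\,k^\star\notin\mathcal C(\lambda)}\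 \sum_{k=1}^K w_k\,d(\mu_k,\lambda_k)$$ over the simplex $\{w\in[0,1]^K:\sum_kw_k=1\}$, and the maximum is $T_2(\mu)^{-1}$. -/

import Mathlib

open MeasureTheory ProbabilityTheory Set
open scoped ENNReal

noncomputable section

namespace Slicing

/-! ### One-parameter exponential families, parameterized by the mean -/

/-- A nondegenerate one-parameter (natural) exponential family on `ℝ`: the distributions with
density proportional to `x ↦ exp (θ * x)` with respect to a reference measure, where `θ` ranges
over an open interval on which `x ↦ exp (θ * x)` is integrable. Poisson and Bernoulli
distributions are of this form, with `Θ = ℝ`. -/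
structure ExpFamily where
  /-- the reference measure -/
  ref : Measure ℝ
  /-- the set of natural parameters -/
  Θ : Set ℝ
  isOpen_Θ : IsOpen Θ
  ordConnected_Θ : Θ.OrdConnected
  integrable_exp : ∀ θ ∈ Θ, Integrable (fun x => Real.exp (θ * x)) ref
  /-- the reference measure is not concentrated at a single point -/
  nondegenerate : ∀ c : ℝ, ref {c}ᶜ ≠ 0

namespace ExpFamily

variable (E : ExpFamily)

/-- The member of the family with natural parameter `θ`. -/
def natLaw (θ : ℝ) : Measure ℝ := E.ref.tilted (fun x => θ * x)

/-- The mean of the member with natural parameter `θ`. -/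
def mean (θ : ℝ) : ℝ := ∫ x, x ∂(E.natLaw θ)

/-- The set of means of the members of the family. -/
def means : Set ℝ := E.mean '' E.Θ

/-- The member of the family whose mean is `a`, for `a ∈ E.means`. -/
def law (a : ℝ) : Measure ℝ := E.natLaw (Function.invFunOn E.mean E.Θ a)

/-- The Kullback-Leibler divergence `d(a, b)` between the members with means `a` and `b`. -/
def d (a b : ℝ) : ℝ := (InformationTheory.klDiv (E.law a) (E.law b)).toReal

end ExpFamily

/-- The Kullback-Leibler divergence `d_B(a, b)` between the Bernoulli distributions with
means `a` and `b`, for `a, b ∈ (0, 1)`. -/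
def dB (a b : ℝ) : ℝ := a * Real.log (a / b) + (1 - a) * Real.log ((1 - a) / (1 - b))

/-! ### The packing-slice criterion -/

section Criterion

variable {K : ℕ}

/-- `k` is a most loaded slice among the available ones (those with load below `γ`). -/
def IsPackingSlice (γ : ℝ) (μ : Fin K → ℝ) (k : Fin K) : Prop :=
  μ k < γ ∧ ∀ j, μ j < γ → μ j ≤ μ k

/-- The set `C(μ) ⊆ {0, …, K}` of correct answers: `0` means rejection, and `k.succ` means that
slice `k` is selected. -/
def correct (γ : ℝ) (μ : Fin K → ℝ) : Set (Fin (K + 1)) :=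
  {a | (a = 0 ∧ ∀ k, γ ≤ μ k) ∨ ∃ k, a = k.succ ∧ IsPackingSlice γ μ k}

/-- The load vectors under consideration: the loads are means of members of the family, no load
equals the threshold, and the most loaded available slice is unique if there is an available
slice. -/
def instances (E : ExpFamily) (γ : ℝ) : Set (Fin K → ℝ) :=
  {μ | (∀ k, μ k ∈ E.means) ∧ (∀ k, μ k ≠ γ) ∧
    ∀ j k, IsPackingSlice γ μ j → IsPackingSlice γ μ k → j = k}

end Criterion

/-! ### Algorithms -/

section Algorithms

/-- Measurements: `ω t k` is the number of packets that slice `k` handles in slot `t + 1`. -/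
abbrev Obs (K : ℕ) : Type := ℕ → Fin K → ℝ

variable {K : ℕ}

/-- The law `P_μ` of the measurements: all `ω t k` are independent, and `ω t k` has the law of
the family with mean `μ k`. -/
def obsLaw (E : ExpFamily) (μ : Fin K → ℝ) : Measure (Obs K) :=
  Measure.infinitePi (fun _ : ℕ => Measure.pi (fun k => E.law (μ k)))

/-- The σ-algebra generated by the slices measured in the first `t` slots and by the values
observed there; `arm s` is the slice measured in slot `s + 1`. -/
@[reducible]
def history (arm : ℕ → Obs K → Fin K) (t : ℕ) : MeasurableSpace (Obs K) :=
  ⨆ s ∈ Set.Iio t, (MeasurableSpace.comap (arm s) ⊤ ⊔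
    MeasurableSpace.comap (fun ω : Obs K => ω s (arm s ω)) (borel ℝ))

/-- A sampling strategy: the slice measured in a slot depends on the past observations only. -/
structure SamplingRule (K : ℕ) where
  /-- `arm t` is the slice measured in slot `t + 1` -/
  arm : ℕ → Obs K → Fin K
  adapted : ∀ t, Measurable[history arm t, ⊤] (arm t)

theorem history_mono (arm : ℕ → Obs K → Fin K) : Monotone (history arm) :=
  fun _ _ h => biSup_mono fun _ hs => lt_of_lt_of_le hs h

theorem history_le_of_measurable (arm : ℕ → Obs K → Fin K) (t : ℕ)
    (h : ∀ s < t, Measurable (arm s)) : history arm t ≤ MeasurableSpace.pi := by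
  refine iSup₂_le fun s hs => sup_le (h s hs).comap_le ?_
  rw [← (inferInstance : BorelSpace ℝ).measurable_eq]
  refine Measurable.comap_le ?_
  refine (measurable_from_prod_countable_left (f := fun p : Obs K × Fin K => p.1 s p.2)
    (fun k => ?_)).comp (measurable_id.prodMk (h s hs))
  exact (measurable_pi_apply k).comp (measurable_pi_apply s)

theorem SamplingRule.measurable_arm (S : SamplingRule K) (t : ℕ) : Measurable (S.arm t) := by
  induction t using Nat.strong_induction_on with
  | _ t ih => exact (S.adapted t).mono (history_le_of_measurable S.arm t ih) le_rfl

/-- The filtration generated by the observations. -/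
def SamplingRule.filtration (S : SamplingRule K) :
    Filtration ℕ (MeasurableSpace.pi : MeasurableSpace (Obs K)) where
  seq := history S.arm
  mono' := history_mono S.arm
  le' := fun t => history_le_of_measurable S.arm t fun s _ => S.measurable_arm s

/-- A joint measurement and decision algorithm: a sampling rule, a stopping time for the
filtration of the observations, and a decision that is measurable at the stopping time. -/
structure Algorithm (K : ℕ) extends SamplingRule K where
  /-- the stopping time -/
  τ : Obs K → ℕ∞
  isStoppingTime : IsStoppingTime toSamplingRule.filtration τ
  /-- the returned decision in `{0, …, K}` -/
  decision : Obs K → Fin (K + 1)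
  measurable_decision : Measurable[isStoppingTime.measurableSpace, ⊤] decision

/-- For every admissible load vector, the algorithm stops almost surely and its decision is wrong
with probability at most `δ`. -/
def Algorithm.IsPC (A : Algorithm K) (E : ExpFamily) (γ δ : ℝ) : Prop :=
  ∀ μ ∈ instances E γ, (∀ᵐ ω ∂(obsLaw E μ), A.τ ω < ⊤) ∧
    obsLaw E μ {ω | A.decision ω ∉ correct γ μ} ≤ ENNReal.ofReal δ

/-- The expected number of measurements `E_μ[τ]`. -/
def Algorithm.expectedTime (A : Algorithm K) (E : ExpFamily) (μ : Fin K → ℝ) : ℝ≥0∞ :=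
  ∫⁻ ω, (A.τ ω : ℝ≥0∞) ∂(obsLaw E μ)

end Algorithms

/-! ### The characteristic time and the optimal proportions -/

section Bound

variable {K : ℕ} (E : ExpFamily) (γ : ℝ) (μ : Fin K → ℝ)

/-- The weighted mean `(μ_k + x μ_j) / (1 + x)`. -/
def mix (j k : Fin K) (x : ℝ) : ℝ := (μ k + x * μ j) / (1 + x)

/-- The information deviation function `g_{j,k}` on `[0, ∞)`. -/
def g (j k : Fin K) (x : ℝ) : ℝ :=
  E.d (μ k) (mix μ j k x) + x * E.d (μ j) (mix μ j k x)

/-- The range of `g_{j,k}`, which is the domain of its inverse. -/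
def gRange (j k : Fin K) : Set ℝ := g E μ j k '' Set.Ici 0

/-- The inverse `x_{j,k}` of `g_{j,k} : [0, ∞) → ℝ`, with the convention `x_{k,k} = 1`. -/
def xInv (j k : Fin K) (y : ℝ) : ℝ :=
  if j = k then 1 else Function.invFunOn (g E μ j k) (Set.Ici 0) y

/-- The equilibrium function `F_k(y; S)`. -/
def F (k : Fin K) (S : Finset (Fin K)) (y : ℝ) : ℝ :=
  ∑ j ∈ S, E.d (μ k) (mix μ j k (xInv E μ j k y)) / E.d (μ j) (mix μ j k (xInv E μ j k y))

/-- The slices that are less loaded than slice `k`. -/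
def lessLoaded (k : Fin K) : Finset (Fin K) := {j | μ j < μ k}

/-- `y` solves `F_k(y; S) = 1` for the set `S` of the slices less loaded than `k`, where `y` lies
in the domain of `F_k(·; S)`. -/
def IsEquilibrium (k : Fin K) (y : ℝ) : Prop :=
  (∀ j ∈ lessLoaded μ k, y ∈ gRange E μ j k) ∧ F E μ k (lessLoaded μ k) y = 1

/-- The solution `y*` of the equilibrium equation. -/
def yStar (k : Fin K) : ℝ := Classical.epsilon (IsEquilibrium E μ k)

/-- `z* = min (d(μ_k, γ), y*)`. If no slice is less loaded than `k`, then the equilibrium function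
vanishes, `y*` is read as `∞`, and `z* = d(μ_k, γ)`. -/
def zStar (k : Fin K) : ℝ :=
  if (lessLoaded μ k).Nonempty then min (E.d (μ k) γ) (yStar E μ k) else E.d (μ k) γ

/-- The characteristic time `T₂(μ)`, where `k` is the packing slice. -/
def T2 (k : Fin K) : ℝ :=
  ∑ j with μ j > μ k, (E.d (μ j) γ)⁻¹ +
    1 / zStar E γ μ k * ∑ j with μ j < γ, xInv E μ j k (zStar E γ μ k)

/-- The measurement proportions `w*(μ)`, where `k` is the packing slice. -/
def wStar (k j : Fin K) : ℝ :=
  1 / T2 E γ μ k *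
    ((if μ j < γ then xInv E μ j k (zStar E γ μ k) / zStar E γ μ k else 0) +
      (if μ j > γ then 1 / E.d (μ j) γ else 0))

/-- The load vectors for which the answer `a` is not correct. -/
def alt (a : Fin (K + 1)) : Set (Fin K → ℝ) := {ν | ν ∈ instances E γ ∧ a ∉ correct γ ν}

/-- The information rate `inf_{ν ∈ Alt(a)} ∑_j w_j d(μ_j, ν_j)` of the proportions `w`. -/
def rate (a : Fin (K + 1)) (w : Fin K → ℝ) : ℝ :=
  sInf ((fun ν : Fin K → ℝ => ∑ j, w j * E.d (μ j) (ν j)) '' alt E γ a)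

end Bound

end Slicing

end

open MeasureTheory ProbabilityTheory Set
open scoped ENNReal

noncomputable section

namespace Slicing

/-! The problem is a linear program: find the least total weight $\sum_j w_j$ such that every
alternative costs at least $r$. Passing to limits of alternatives gives simple constraints: $w_j
d(\mu_j,\gamma)\ge r$ for unavailable $j$ and for $j=k$, and $w_k d(\mu_k,m)+w_j d(\mu_j,m)\ge r$
for less loaded $j$ and any $m<\gamma$. For each less loaded $j$ one value of $m$ suffices, the mean
`mStar` of $\mu_k$ and $\mu_j$ with weights $1$ and $x_{j,k}(z^\star)$.

The identity `sum_sub_T2_mul` writes $\sum_j w_j-T_2r$ as a combination of slacks. Its coefficients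
are nonnegative because $z^\star\le y^\star$ forces $F(z^\star)\le1$. The slack of the threshold
constraint on $k$ enters with a factor $1-F(z^\star)$, which vanishes unless
$z^\star=d(\mu_k,\gamma)$ (`F_zStar`). This gives weak duality (`T2_mul_le_sum`) and, through
complementary slackness, uniqueness (`eq_of_sum_eq_T2_mul`). Conversely `inv_T2_le_cost_wStar` shows
that `wStar` is feasible. All of this rests on the compensation identity `mul_d_add_mul_d`, which
makes $g_{j,k}(x)$ the minimum over $m$ of $d(\mu_k,m)+x\,d(\mu_j,m)$.

For the lower bound on $\mathbb E_\mu[\tau]$, weak duality is applied to the expected numbers of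
measurements before $\min(\tau,n)$. Their cost against each alternative is bounded below by a change
of measure (`log_mul_le_sum_expectedCount`), and $n\to\infty$ finishes. -/

theorem continuousOn_invFunOn_image {f : ℝ → ℝ} {s : Set ℝ} (hs : s.OrdConnected)
    (hf : StrictMonoOn f s) (hc : ContinuousOn f s) :
    ContinuousOn (Function.invFunOn f s) (f '' s) := by
  -- On an order-connected set the subspace topology is the order topology, in which an order
  -- isomorphism is continuous.
  have hi : (f '' s).OrdConnected := (hs.isPreconnected.image f hc).ordConnected
  have h1 : Continuous fun y : f '' s => (((hf.orderIso f s).symm y : s) : ℝ) :=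
    continuous_subtype_val.comp (hf.orderIso f s).symm.continuous
  rw [continuousOn_iff_continuous_domRestrict]
  convert h1 using 1
  ext y
  obtain ⟨x, rfl⟩ := (hf.orderIso f s).surjective y
  rw [OrderIso.symm_apply_apply]
  exact hf.injOn.leftInvOn_invFunOn x.2

/-! ### Exponential families: means, divergences, the compensation identity -/

namespace ExpFamily

variable (E : ExpFamily)

/-- The log-partition function. -/
def logPartition (θ : ℝ) : ℝ := cgf id E.ref θ

/-- The natural parameter of the member of the family with mean `a`. -/
def natParam (a : ℝ) : ℝ := Function.invFunOn E.mean E.Θ a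

variable {E}

theorem mem_interior_integrableExpSet {θ : ℝ} (h : θ ∈ E.Θ) :
    θ ∈ interior (integrableExpSet id E.ref) :=
  interior_maximal (fun t ht => E.integrable_exp t ht) E.isOpen_Θ h

theorem ref_ne_zero (E : ExpFamily) : NeZero E.ref :=
  ⟨fun h => E.nondegenerate 0 (by simp [h])⟩

theorem isProbabilityMeasure_natLaw {θ : ℝ} (h : θ ∈ E.Θ) :
    IsProbabilityMeasure (E.natLaw θ) :=
  have := E.ref_ne_zero
  isProbabilityMeasure_tilted (E.integrable_exp θ h)

theorem integrable_id_natLaw {θ : ℝ} (h : θ ∈ E.Θ) : Integrable (fun x => x) (E.natLaw θ) :=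
  (memLp_one_iff_integrable (f := id)).1
    (by simpa using! memLp_tilted_mul (mem_interior_integrableExpSet h) 1)

theorem exp_logPartition {θ : ℝ} (h : θ ∈ E.Θ) :
    Real.exp (E.logPartition θ) = ∫ x, Real.exp (θ * x) ∂E.ref := by
  have := E.ref_ne_zero
  exact exp_cgf (X := id) (E.integrable_exp θ h)

theorem tilted_natLaw {θ : ℝ} (h : θ ∈ E.Θ) (t : ℝ) :
    (E.natLaw θ).tilted (fun x => (t - θ) * x) = E.natLaw t := by
  rw [natLaw, tilted_tilted (E.integrable_exp θ h), natLaw]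
  congr 1
  ext x
  simp only [Pi.add_apply]
  ring

theorem integral_exp_natLaw {θ t : ℝ} (h : θ ∈ E.Θ) (ht : t ∈ E.Θ) :
    ∫ x, Real.exp ((t - θ) * x) ∂(E.natLaw θ)
      = Real.exp (E.logPartition t - E.logPartition θ) := by
  rw [natLaw, integral_exp_tilted (fun x => θ * x) (fun x => (t - θ) * x), Real.exp_sub,
    exp_logPartition h, exp_logPartition ht]
  congr 2
  ext x
  simp only [Pi.add_apply]
  congr 1
  ring

theorem integrable_exp_natLaw {θ t : ℝ} (h : θ ∈ E.Θ) (ht : t ∈ E.Θ) :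
    Integrable (fun x => Real.exp ((t - θ) * x)) (E.natLaw θ) := by
  -- A non-integrable function has Bochner integral `0`, but the integral was found to be an
  -- exponential.
  by_contra hn
  have := integral_undef hn
  rw [integral_exp_natLaw h ht] at this
  exact (Real.exp_pos _).ne' this

theorem natLaw_eq_withDensity {θ t : ℝ} (h : θ ∈ E.Θ) (ht : t ∈ E.Θ) :
    E.natLaw t = (E.natLaw θ).withDensity (fun x =>
      ENNReal.ofReal (Real.exp ((t - θ) * x - (E.logPartition t - E.logPartition θ)))) := by
  rw [← tilted_natLaw h t, Measure.tilted]
  congr 1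
  ext x
  rw [integral_exp_natLaw h ht, Real.exp_sub ((t - θ) * x)]

theorem absolutelyContinuous_natLaw {θ t : ℝ} (h : θ ∈ E.Θ) :
    E.natLaw t ≪ E.natLaw θ := by
  rw [← tilted_natLaw h t]
  exact tilted_absolutelyContinuous _ _

theorem llr_natLaw {θ t : ℝ} (h : θ ∈ E.Θ) (ht : t ∈ E.Θ) :
    llr (E.natLaw t) (E.natLaw θ) =ᵐ[E.natLaw θ] fun x =>
      (t - θ) * x - (E.logPartition t - E.logPartition θ) := by
  have := isProbabilityMeasure_natLaw h
  have := log_rnDeriv_tilted_left_self (integrable_exp_natLaw h ht)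
  rw [tilted_natLaw h t, integral_exp_natLaw h ht, Real.log_exp] at this
  exact this

theorem integrable_logDensity_natLaw {θ : ℝ} (h : θ ∈ E.Θ) (c c' : ℝ) :
    Integrable (fun x => c * x - c') (E.natLaw θ) := by
  have := isProbabilityMeasure_natLaw h
  exact ((integrable_id_natLaw h).const_mul _).sub (integrable_const _)

theorem integral_logDensity_natLaw {θ : ℝ} (h : θ ∈ E.Θ) (c c' : ℝ) :
    ∫ x, (c * x - c') ∂(E.natLaw θ) = c * E.mean θ - c' := by
  have := isProbabilityMeasure_natLaw h
  rw [integral_sub ((integrable_id_natLaw h).const_mul _) (integrable_const _),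
    integral_const_mul, mean]
  simp

/-- The log-likelihood ratio is affine in the observation, so its expectation involves the law only
through its mean. -/
theorem toReal_klDiv_natLaw {θ t : ℝ} (h : θ ∈ E.Θ) (ht : t ∈ E.Θ) :
    (InformationTheory.klDiv (E.natLaw t) (E.natLaw θ)).toReal =
      (t - θ) * E.mean t - (E.logPartition t - E.logPartition θ) := by
  have := isProbabilityMeasure_natLaw h
  have := isProbabilityMeasure_natLaw ht
  have hac : E.natLaw t ≪ E.natLaw θ := absolutelyContinuous_natLaw h
  rw [InformationTheory.toReal_klDiv_of_measure_eq hac (by simp),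
    integral_congr_ae (hac.ae_le (llr_natLaw h ht)), integral_logDensity_natLaw ht]

theorem klDiv_natLaw_ne_top {θ t : ℝ} (h : θ ∈ E.Θ) (ht : t ∈ E.Θ) :
    InformationTheory.klDiv (E.natLaw t) (E.natLaw θ) ≠ ∞ := by
  have hac : E.natLaw t ≪ E.natLaw θ := absolutelyContinuous_natLaw h
  have hae := hac.ae_eq (llr_natLaw h ht)
  exact InformationTheory.klDiv_ne_top hac
    ((integrable_logDensity_natLaw ht _ _).congr hae.symm)

/-- If two parameters gave the same law, their affine log-likelihood ratio would vanish almost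
everywhere and pin `x` to one point, against nondegeneracy. -/
theorem natLaw_injOn : InjOn E.natLaw E.Θ := by
  intro t ht θ h heq
  by_contra hne
  have := isProbabilityMeasure_natLaw h
  have h1 := llr_natLaw h ht
  rw [heq] at h1
  have h2 := (llr_self (E.natLaw θ)).symm.trans h1
  have hsub : t - θ ≠ 0 := sub_ne_zero.2 hne
  have h3 : ∀ᵐ x ∂(E.natLaw θ), x = (E.logPartition t - E.logPartition θ) / (t - θ) := by
    filter_upwards [h2] with x hx
    simp only [Pi.zero_apply] at hx
    field_simp
    linarith
  have h4 := (absolutelyContinuous_tilted (E.integrable_exp θ h)).ae_le h3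
  exact E.nondegenerate _ h4

theorem toReal_klDiv_natLaw_pos {θ t : ℝ} (h : θ ∈ E.Θ) (ht : t ∈ E.Θ) (hne : t ≠ θ) :
    0 < (InformationTheory.klDiv (E.natLaw t) (E.natLaw θ)).toReal := by
  have := isProbabilityMeasure_natLaw h
  have := isProbabilityMeasure_natLaw ht
  refine ENNReal.toReal_pos (fun h0 => hne ?_) (klDiv_natLaw_ne_top h ht)
  exact natLaw_injOn ht h (InformationTheory.klDiv_eq_zero_iff.1 h0)

/-- The two divergences between the members add up to
$(t-\theta)(\mathrm{mean}\,t-\mathrm{mean}\,\theta)$, which is therefore positive. -/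
theorem strictMonoOn_mean : StrictMonoOn E.mean E.Θ := by
  intro t ht θ h hlt
  have h1 := toReal_klDiv_natLaw_pos h ht hlt.ne
  have h2 := toReal_klDiv_natLaw_pos ht h hlt.ne'
  rw [toReal_klDiv_natLaw h ht] at h1
  rw [toReal_klDiv_natLaw ht h] at h2
  by_contra hn
  nlinarith

theorem continuousOn_mean : ContinuousOn E.mean E.Θ := by
  have h : ContinuousOn (deriv (cgf id E.ref)) E.Θ := fun θ hθ =>
    (analyticAt_cgf (mem_interior_integrableExpSet hθ)).deriv.continuousAt.continuousWithinAt
  exact h.congr fun θ hθ => integral_tilted_mul_self (mem_interior_integrableExpSet hθ)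

theorem continuousOn_logPartition : ContinuousOn E.logPartition E.Θ := fun _ hθ =>
  (analyticAt_cgf (mem_interior_integrableExpSet hθ)).continuousAt.continuousWithinAt

theorem ordConnected_means : E.means.OrdConnected :=
  (E.ordConnected_Θ.isPreconnected.image _ continuousOn_mean).ordConnected

theorem isOpen_means : IsOpen E.means := by
  rw [isOpen_iff_mem_nhds]
  rintro _ ⟨θ, h, rfl⟩
  obtain ⟨l, u, hlu, hsub⟩ := mem_nhds_iff_exists_Ioo_subset.1 (E.isOpen_Θ.mem_nhds h)
  obtain ⟨l', hl⟩ := exists_between hlu.1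
  obtain ⟨u', hu⟩ := exists_between hlu.2
  have hl' : l' ∈ E.Θ := hsub ⟨hl.1, hl.2.trans hlu.2⟩
  have hu' : u' ∈ E.Θ := hsub ⟨hlu.1.trans hu.1, hu.2⟩
  exact Filter.mem_of_superset
    (Icc_mem_nhds (strictMonoOn_mean hl' h hl.2) (strictMonoOn_mean h hu' hu.1))
    (ordConnected_means.out (mem_image_of_mem _ hl') (mem_image_of_mem _ hu'))

theorem natParam_mem {a : ℝ} (ha : a ∈ E.means) : E.natParam a ∈ E.Θ :=
  Function.invFunOn_mem ha

theorem mean_natParam {a : ℝ} (ha : a ∈ E.means) : E.mean (E.natParam a) = a :=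
  Function.invFunOn_eq ha

theorem continuousOn_natParam : ContinuousOn E.natParam E.means :=
  continuousOn_invFunOn_image E.ordConnected_Θ strictMonoOn_mean continuousOn_mean

theorem natParam_lt_natParam {a b : ℝ} (ha : a ∈ E.means) (hb : b ∈ E.means) (h : a < b) :
    E.natParam a < E.natParam b := by
  rw [← strictMonoOn_mean.lt_iff_lt (natParam_mem ha) (natParam_mem hb), mean_natParam ha,
    mean_natParam hb]
  exact h

theorem isProbabilityMeasure_law {a : ℝ} (ha : a ∈ E.means) : IsProbabilityMeasure (E.law a) :=
  isProbabilityMeasure_natLaw (natParam_mem ha)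

theorem d_eq {a b : ℝ} (ha : a ∈ E.means) (hb : b ∈ E.means) :
    E.d a b = (E.natParam a - E.natParam b) * a -
      (E.logPartition (E.natParam a) - E.logPartition (E.natParam b)) := by
  have := toReal_klDiv_natLaw (natParam_mem hb) (natParam_mem ha)
  rwa [mean_natParam ha] at this

theorem d_nonneg (a b : ℝ) : 0 ≤ E.d a b := ENNReal.toReal_nonneg

theorem d_pos {a b : ℝ} (ha : a ∈ E.means) (hb : b ∈ E.means) (h : a ≠ b) : 0 < E.d a b := by
  refine toReal_klDiv_natLaw_pos (natParam_mem hb) (natParam_mem ha) fun h' => h ?_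
  have h' : E.natParam a = E.natParam b := h'
  rw [← mean_natParam ha, h', mean_natParam hb]

theorem d_self {a : ℝ} (ha : a ∈ E.means) : E.d a a = 0 := by
  rw [d_eq ha ha]
  ring

theorem continuousOn_d {a : ℝ} (ha : a ∈ E.means) : ContinuousOn (E.d a) E.means := by
  refine ContinuousOn.congr ?_ fun b hb => d_eq ha hb
  exact ((continuousOn_const.sub continuousOn_natParam).mul continuousOn_const).sub
    (continuousOn_const.sub
      (continuousOn_logPartition.comp continuousOn_natParam fun b hb => natParam_mem hb))

/-- Three-point identity: $d(a,c)-d(a,b)=d(b,c)+(b-a)(\theta_c-\theta_b)$, where $\theta$ denotes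
`natParam`. -/
theorem d_lt_d_of_lt_of_lt {a b c : ℝ} (ha : a ∈ E.means) (hc : c ∈ E.means)
    (hab : a < b) (hbc : b < c) : E.d a b < E.d a c := by
  have hb : b ∈ E.means := ordConnected_means.out ha hc ⟨hab.le, hbc.le⟩
  have h1 := natParam_lt_natParam hb hc hbc
  have h2 := d_nonneg (E := E) b c
  rw [d_eq hb hc] at h2
  rw [d_eq ha hb, d_eq ha hc]
  nlinarith [mul_pos (sub_pos.2 hab) (sub_pos.2 h1)]

theorem d_lt_d_of_gt_of_gt {a b c : ℝ} (ha : a ∈ E.means) (hc : c ∈ E.means)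
    (hab : b < a) (hbc : c < b) : E.d a b < E.d a c := by
  have hb : b ∈ E.means := ordConnected_means.out hc ha ⟨hbc.le, hab.le⟩
  have h1 := natParam_lt_natParam hc hb hbc
  have h2 := d_nonneg (E := E) b c
  rw [d_eq hb hc] at h2
  rw [d_eq ha hb, d_eq ha hc]
  nlinarith [mul_pos (sub_pos.2 hab) (sub_pos.2 h1)]

/-- The compensation identity: the weighted divergence to `m` splits at the weighted mean `c`. -/
theorem mul_d_add_mul_d {a b c m p q : ℝ} (ha : a ∈ E.means) (hb : b ∈ E.means)
    (hc : c ∈ E.means) (hm : m ∈ E.means) (h : p * a + q * b = (p + q) * c) :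
    p * E.d a m + q * E.d b m = p * E.d a c + q * E.d b c + (p + q) * E.d c m := by
  rw [d_eq ha hm, d_eq hb hm, d_eq ha hc, d_eq hb hc, d_eq hc hm]
  linear_combination (E.natParam c - E.natParam m) * h

/-- The logarithm of the density of the member with mean `b` with respect to that with mean `a`. -/
def logRatio (E : ExpFamily) (a b x : ℝ) : ℝ :=
  (E.natParam b - E.natParam a) * x -
    (E.logPartition (E.natParam b) - E.logPartition (E.natParam a))

theorem measurable_logRatio (a b : ℝ) : Measurable (E.logRatio a b) := by
  unfold logRatio
  fun_prop

theorem law_eq_withDensity {a b : ℝ} (ha : a ∈ E.means) (hb : b ∈ E.means) :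
    E.law b = (E.law a).withDensity (fun x => ENNReal.ofReal (Real.exp (E.logRatio a b x))) :=
  natLaw_eq_withDensity (natParam_mem ha) (natParam_mem hb)

theorem integrable_logRatio {a : ℝ} (ha : a ∈ E.means) (b : ℝ) :
    Integrable (E.logRatio a b) (E.law a) :=
  integrable_logDensity_natLaw (natParam_mem ha) _ _

theorem integral_logRatio {a b : ℝ} (ha : a ∈ E.means) (hb : b ∈ E.means) :
    ∫ x, E.logRatio a b x ∂(E.law a) = -E.d a b := by
  have := integral_logDensity_natLaw (natParam_mem ha) (E.natParam b - E.natParam a)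
    (E.logPartition (E.natParam b) - E.logPartition (E.natParam a))
  rw [mean_natParam ha] at this
  rw [d_eq ha hb]
  refine this.trans ?_
  ring

end ExpFamily

/-! ### Comparison of two slices: the function $g_{j,k}$ and its inverse -/

section TwoSlices

open Filter Topology

variable {K : ℕ} {E : ExpFamily} {μ : Fin K → ℝ} {j k : Fin K}

theorem one_add_mul_mix {x : ℝ} (hx : 0 ≤ x) : 1 * μ k + x * μ j = (1 + x) * mix μ j k x := by
  have : 1 + x ≠ 0 := by positivity
  rw [mix]
  field_simp

theorem mix_eq {x : ℝ} (hx : 0 ≤ x) : mix μ j k x = μ j + (μ k - μ j) / (1 + x) := by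
  have : 1 + x ≠ 0 := by positivity
  rw [mix]
  field_simp
  ring

theorem mix_zero : mix μ j k 0 = μ k := by simp [mix]

theorem lt_mix (hlt : μ j < μ k) {x : ℝ} (hx : 0 ≤ x) : μ j < mix μ j k x := by
  rw [mix_eq hx]
  have : 0 < (μ k - μ j) / (1 + x) := div_pos (sub_pos.2 hlt) (by positivity)
  linarith

theorem mix_lt_mix (hlt : μ j < μ k) {x y : ℝ} (hx : 0 ≤ x) (hxy : x < y) :
    mix μ j k y < mix μ j k x := by
  rw [mix_eq hx, mix_eq (hx.trans hxy.le)]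
  have := div_lt_div_of_pos_left (sub_pos.2 hlt) (by linarith : 0 < 1 + x)
    (by linarith : 1 + x < 1 + y)
  linarith

theorem mix_le (hlt : μ j < μ k) {x : ℝ} (hx : 0 ≤ x) : mix μ j k x ≤ μ k := by
  rcases hx.eq_or_lt with rfl | hx
  · rw [mix_zero]
  · exact ((mix_lt_mix hlt le_rfl hx).trans_eq mix_zero).le

theorem mix_mem_means (hj : μ j ∈ E.means) (hk : μ k ∈ E.means) (hlt : μ j < μ k) {x : ℝ}
    (hx : 0 ≤ x) : mix μ j k x ∈ E.means :=
  ExpFamily.ordConnected_means.out hj hk ⟨(lt_mix hlt hx).le, mix_le hlt hx⟩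

theorem continuousOn_mix : ContinuousOn (mix μ j k) (Ici 0) := by
  unfold mix
  refine ContinuousOn.div (by fun_prop) (by fun_prop) fun x hx => ?_
  have : (0 : ℝ) ≤ x := hx
  positivity

theorem tendsto_mix : Tendsto (mix μ j k) atTop (𝓝 (μ j)) := by
  have h : Tendsto (fun x : ℝ => μ j + (μ k - μ j) / (1 + x)) atTop (𝓝 (μ j + 0)) :=
    tendsto_const_nhds.add
      (tendsto_const_nhds.div_atTop (tendsto_atTop_add_const_left _ _ tendsto_id))
  rw [add_zero] at h
  refine h.congr' ?_
  filter_upwards [eventually_ge_atTop 0] with x hx using (mix_eq hx).symm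

theorem continuousOn_d_mix (hj : μ j ∈ E.means) (hk : μ k ∈ E.means) (hlt : μ j < μ k) {a : ℝ}
    (ha : a ∈ E.means) : ContinuousOn (fun x => E.d a (mix μ j k x)) (Ici 0) :=
  (ExpFamily.continuousOn_d ha).comp continuousOn_mix fun _ hx => mix_mem_means hj hk hlt hx

theorem tendsto_d_mix (hj : μ j ∈ E.means) {a : ℝ} (ha : a ∈ E.means) :
    Tendsto (fun x => E.d a (mix μ j k x)) atTop (𝓝 (E.d a (μ j))) :=
  ((ExpFamily.continuousOn_d ha).continuousAt
    (ExpFamily.isOpen_means.mem_nhds hj)).tendsto.comp tendsto_mix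

theorem d_mix_pos (hj : μ j ∈ E.means) (hk : μ k ∈ E.means) (hlt : μ j < μ k) {x : ℝ}
    (hx : 0 ≤ x) : 0 < E.d (μ j) (mix μ j k x) :=
  ExpFamily.d_pos hj (mix_mem_means hj hk hlt hx) (lt_mix hlt hx).ne

theorem strictMonoOn_d_mix_left (hj : μ j ∈ E.means) (hk : μ k ∈ E.means) (hlt : μ j < μ k) :
    StrictMonoOn (fun x => E.d (μ k) (mix μ j k x)) (Ici 0) := by
  intro x hx y hy hxy
  have hx' : (0 : ℝ) ≤ x := hx
  rcases hx'.eq_or_lt with rfl | hx0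
  · simp only [mix_zero, ExpFamily.d_self hk]
    exact ExpFamily.d_pos hk (mix_mem_means hj hk hlt hy)
      ((mix_lt_mix hlt le_rfl hxy).trans_eq mix_zero).ne'
  · exact ExpFamily.d_lt_d_of_gt_of_gt hk (mix_mem_means hj hk hlt hy)
      ((mix_lt_mix hlt le_rfl hx0).trans_eq mix_zero) (mix_lt_mix hlt hx hxy)

theorem strictAntiOn_d_mix_right (hj : μ j ∈ E.means) (hk : μ k ∈ E.means) (hlt : μ j < μ k) :
    StrictAntiOn (fun x => E.d (μ j) (mix μ j k x)) (Ici 0) := fun _ hx _ hy hxy =>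
  ExpFamily.d_lt_d_of_lt_of_lt hj (mix_mem_means hj hk hlt hx) (lt_mix hlt hy)
    (mix_lt_mix hlt hx hxy)

theorem d_add_mul_d (hj : μ j ∈ E.means) (hk : μ k ∈ E.means) (hlt : μ j < μ k) {x m : ℝ}
    (hx : 0 ≤ x) (hm : m ∈ E.means) :
    E.d (μ k) m + x * E.d (μ j) m = g E μ j k x + (1 + x) * E.d (mix μ j k x) m := by
  have := ExpFamily.mul_d_add_mul_d hk hj (mix_mem_means hj hk hlt hx) hm (one_add_mul_mix hx)
  rw [g]
  linarith

/-- The excess is $(1+x)\,d(\mathrm{mix},m)$, so the weighted mean minimizes the weighted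
divergence. -/
theorem g_le (hj : μ j ∈ E.means) (hk : μ k ∈ E.means) (hlt : μ j < μ k) {x m : ℝ}
    (hx : 0 ≤ x) (hm : m ∈ E.means) : g E μ j k x ≤ E.d (μ k) m + x * E.d (μ j) m := by
  rw [d_add_mul_d hj hk hlt hx hm]
  have := mul_nonneg (by positivity : 0 ≤ 1 + x) (ExpFamily.d_nonneg (E := E) (mix μ j k x) m)
  linarith

theorem g_zero (hk : μ k ∈ E.means) : g E μ j k 0 = 0 := by
  simp [g, mix_zero, ExpFamily.d_self hk]

/-- As a minimum over $m$ of functions increasing in $x$, `g` increases: the minimizer belonging to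
the larger argument serves as a competitor at the smaller one. -/
theorem strictMonoOn_g (hj : μ j ∈ E.means) (hk : μ k ∈ E.means) (hlt : μ j < μ k) :
    StrictMonoOn (g E μ j k) (Ici 0) := by
  intro x hx y hy hxy
  refine (g_le hj hk hlt hx (mix_mem_means hj hk hlt hy)).trans_lt ?_
  rw [g]
  have := d_mix_pos hj hk hlt hy
  gcongr

theorem continuousOn_g (hj : μ j ∈ E.means) (hk : μ k ∈ E.means) (hlt : μ j < μ k) :
    ContinuousOn (g E μ j k) (Ici 0) :=
  (continuousOn_d_mix hj hk hlt hk).add (continuousOn_id.mul (continuousOn_d_mix hj hk hlt hj))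

theorem g_lt_d (hj : μ j ∈ E.means) (hk : μ k ∈ E.means) (hlt : μ j < μ k) {x : ℝ}
    (hx : 0 ≤ x) : g E μ j k x < E.d (μ k) (μ j) := by
  have h1 := d_add_mul_d hj hk hlt hx hj
  rw [ExpFamily.d_self hj] at h1
  have h2 := mul_pos (by positivity : 0 < 1 + x)
    (ExpFamily.d_pos (mix_mem_means hj hk hlt hx) hj (lt_mix hlt hx).ne')
  linarith

/-- The supremum is approached as $x\to\infty$, when the mixture tends to $\mu_j$, and `g_lt_d`
shows that it is not attained. -/
theorem gRange_eq (hj : μ j ∈ E.means) (hk : μ k ∈ E.means) (hlt : μ j < μ k) :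
    gRange E μ j k = Ico 0 (E.d (μ k) (μ j)) := by
  ext y
  constructor
  · rintro ⟨x, hx, rfl⟩
    refine ⟨?_, g_lt_d hj hk hlt hx⟩
    rw [← g_zero (j := j) hk]
    exact (strictMonoOn_g hj hk hlt).monotoneOn self_mem_Ici hx hx
  · rintro ⟨h0, h1⟩
    obtain ⟨X, hX0, hX⟩ := ((eventually_ge_atTop 0).and
      ((tendsto_d_mix (k := k) hj hk).eventually_const_lt h1)).exists
    have hgX : y ≤ g E μ j k X := by
      rw [g]
      have := mul_nonneg hX0 (ExpFamily.d_nonneg (E := E) (μ j) (mix μ j k X))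
      linarith
    obtain ⟨x, hx, rfl⟩ := intermediate_value_Icc hX0
      ((continuousOn_g hj hk hlt).mono Icc_subset_Ici_self)
      (by rw [g_zero hk]; exact ⟨h0, hgX⟩)
    exact ⟨x, hx.1, rfl⟩

theorem xInv_self (y : ℝ) : xInv E μ k k y = 1 := if_pos rfl

theorem xInv_eq (hlt : μ j < μ k) : xInv E μ j k = Function.invFunOn (g E μ j k) (Ici 0) := by
  ext y
  exact if_neg fun h => hlt.ne (by rw [h])

theorem xInv_nonneg (hlt : μ j < μ k) {y : ℝ} (hy : y ∈ gRange E μ j k) :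
    0 ≤ xInv E μ j k y := by
  rw [xInv_eq hlt]
  exact Function.invFunOn_mem hy

theorem g_xInv (hlt : μ j < μ k) {y : ℝ} (hy : y ∈ gRange E μ j k) :
    g E μ j k (xInv E μ j k y) = y := by
  rw [xInv_eq hlt]
  exact Function.invFunOn_eq hy

theorem xInv_zero (hj : μ j ∈ E.means) (hk : μ k ∈ E.means) (hlt : μ j < μ k) :
    xInv E μ j k 0 = 0 := by
  have h0 : (0 : ℝ) ∈ gRange E μ j k := ⟨0, self_mem_Ici, g_zero hk⟩
  exact (strictMonoOn_g hj hk hlt).injOn (xInv_nonneg hlt h0) self_mem_Ici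
    ((g_xInv hlt h0).trans (g_zero hk).symm)

theorem continuousOn_xInv (hj : μ j ∈ E.means) (hk : μ k ∈ E.means) (hlt : μ j < μ k) :
    ContinuousOn (xInv E μ j k) (gRange E μ j k) := by
  rw [xInv_eq hlt]
  exact continuousOn_invFunOn_image ordConnected_Ici (strictMonoOn_g hj hk hlt)
    (continuousOn_g hj hk hlt)

theorem strictMonoOn_xInv (hj : μ j ∈ E.means) (hk : μ k ∈ E.means) (hlt : μ j < μ k) :
    StrictMonoOn (xInv E μ j k) (gRange E μ j k) := by
  intro y hy z hz hyz
  rw [← (strictMonoOn_g hj hk hlt).lt_iff_lt (xInv_nonneg hlt hy) (xInv_nonneg hlt hz),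
    g_xInv hlt hy, g_xInv hlt hz]
  exact hyz

/-- The contribution of slice `j` to the equilibrium function. -/
def mixRatio (E : ExpFamily) (μ : Fin K → ℝ) (j k : Fin K) (x : ℝ) : ℝ :=
  E.d (μ k) (mix μ j k x) / E.d (μ j) (mix μ j k x)

theorem strictMonoOn_mixRatio (hj : μ j ∈ E.means) (hk : μ k ∈ E.means) (hlt : μ j < μ k) :
    StrictMonoOn (mixRatio E μ j k) (Ici 0) := fun _ hx _ hy hxy =>
  div_lt_div₀ (strictMonoOn_d_mix_left hj hk hlt hx hy hxy)
    (strictAntiOn_d_mix_right hj hk hlt hx hy hxy).le (ExpFamily.d_nonneg _ _)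
    (d_mix_pos hj hk hlt hy)

theorem continuousOn_mixRatio (hj : μ j ∈ E.means) (hk : μ k ∈ E.means) (hlt : μ j < μ k) :
    ContinuousOn (mixRatio E μ j k) (Ici 0) :=
  (continuousOn_d_mix hj hk hlt hk).div (continuousOn_d_mix hj hk hlt hj) fun _ hx =>
    (d_mix_pos hj hk hlt hx).ne'

theorem mixRatio_nonneg (x : ℝ) : 0 ≤ mixRatio E μ j k x :=
  div_nonneg (ExpFamily.d_nonneg _ _) (ExpFamily.d_nonneg _ _)

/-- As $x\to\infty$ the numerator tends to $d(\mu_k,\mu_j)>0$ and the denominator to $0$. -/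
theorem exists_one_le_mixRatio (hj : μ j ∈ E.means) (hk : μ k ∈ E.means) (hlt : μ j < μ k) :
    ∃ x, 0 ≤ x ∧ 1 ≤ mixRatio E μ j k x := by
  have hpos := ExpFamily.d_pos hk hj hlt.ne'
  have h2 := tendsto_d_mix (k := k) hj hj
  rw [ExpFamily.d_self hj] at h2
  obtain ⟨x, hx, h3⟩ := ((eventually_ge_atTop 0).and
    (h2.eventually_lt (tendsto_d_mix (k := k) hj hk) hpos)).exists
  exact ⟨x, hx, (one_le_div (d_mix_pos hj hk hlt hx)).2 h3.le⟩

end TwoSlices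

/-! ### The equilibrium equation, $y^\star$ and $z^\star$ -/

section Equilibrium

variable {K : ℕ} {E : ExpFamily} {γ : ℝ} {μ : Fin K → ℝ} {k : Fin K}

theorem mem_lessLoaded {j : Fin K} : j ∈ lessLoaded μ k ↔ μ j < μ k := by
  simp [lessLoaded]

theorem F_eq (S : Finset (Fin K)) (y : ℝ) :
    F E μ k S y = ∑ j ∈ S, mixRatio E μ j k (xInv E μ j k y) := rfl

theorem F_lessLoaded_zero (hm : ∀ i, μ i ∈ E.means) : F E μ k (lessLoaded μ k) 0 = 0 := by
  rw [F_eq]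
  refine Finset.sum_eq_zero fun j hj => ?_
  rw [xInv_zero (hm j) (hm k) (mem_lessLoaded.1 hj), mixRatio, mix_zero, ExpFamily.d_self (hm k),
    zero_div]

theorem F_lt_F (hm : ∀ i, μ i ∈ E.means) (hne : (lessLoaded μ k).Nonempty) {y z : ℝ}
    (hy : ∀ j ∈ lessLoaded μ k, y ∈ gRange E μ j k)
    (hz : ∀ j ∈ lessLoaded μ k, z ∈ gRange E μ j k) (hyz : y < z) :
    F E μ k (lessLoaded μ k) y < F E μ k (lessLoaded μ k) z := by
  rw [F_eq, F_eq]
  refine Finset.sum_lt_sum_of_nonempty hne fun j hj => ?_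
  have hlt := mem_lessLoaded.1 hj
  exact strictMonoOn_mixRatio (hm j) (hm k) hlt (xInv_nonneg hlt (hy j hj))
    (xInv_nonneg hlt (hz j hj))
    (strictMonoOn_xInv (hm j) (hm k) hlt (hy j hj) (hz j hj) hyz)

theorem mem_gRange_of_le (hm : ∀ i, μ i ∈ E.means) {j : Fin K} (hlt : μ j < μ k) {y z : ℝ}
    (hz : z ∈ gRange E μ j k) (h0 : 0 ≤ y) (hyz : y ≤ z) : y ∈ gRange E μ j k := by
  rw [gRange_eq (hm j) (hm k) hlt] at hz ⊢
  exact ⟨h0, hyz.trans_lt hz.2⟩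

theorem exists_isEquilibrium (hm : ∀ i, μ i ∈ E.means) (hne : (lessLoaded μ k).Nonempty) :
    ∃ y, IsEquilibrium E μ k y := by
  -- The most loaded of these slices has the smallest range $[0,d(\mu_k,\mu_i))$, which is thus the
  -- common domain. Its term alone lifts `F` to `1` within that domain, while `F` vanishes at `0`.
  obtain ⟨i, hi, hmax⟩ := (lessLoaded μ k).exists_max_image μ hne
  have hik := mem_lessLoaded.1 hi
  have hdom : ∀ y ∈ gRange E μ i k, ∀ j ∈ lessLoaded μ k, y ∈ gRange E μ j k := by
    intro y hy j hj
    rw [gRange_eq (hm i) (hm k) hik] at hy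
    rw [gRange_eq (hm j) (hm k) (mem_lessLoaded.1 hj)]
    refine ⟨hy.1, hy.2.trans_le ?_⟩
    rcases (hmax j hj).eq_or_lt with h | h
    · rw [h]
    · exact (ExpFamily.d_lt_d_of_gt_of_gt (hm k) (hm j) hik h).le
  obtain ⟨x, hx, h1⟩ := exists_one_le_mixRatio (hm i) (hm k) hik
  have hY : g E μ i k x ∈ gRange E μ i k := mem_image_of_mem _ hx
  have hY0 : 0 ≤ g E μ i k x := by
    have := hY
    rw [gRange_eq (hm i) (hm k) hik] at this
    exact this.1
  have hFY : 1 ≤ F E μ k (lessLoaded μ k) (g E μ i k x) := by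
    refine h1.trans ?_
    have hxi : xInv E μ i k (g E μ i k x) = x :=
      (strictMonoOn_g (hm i) (hm k) hik).injOn (xInv_nonneg hik hY) hx (g_xInv hik hY)
    rw [F_eq]
    conv_lhs => rw [← hxi]
    exact Finset.single_le_sum (f := fun j => mixRatio E μ j k (xInv E μ j k (g E μ i k x)))
      (fun j _ => mixRatio_nonneg _) hi
  have hsub : ∀ y ∈ Icc 0 (g E μ i k x), ∀ j ∈ lessLoaded μ k, y ∈ gRange E μ j k :=
    fun y hy => hdom y (mem_gRange_of_le hm hik hY hy.1 hy.2)
  have hcont : ContinuousOn (F E μ k (lessLoaded μ k)) (Icc 0 (g E μ i k x)) := by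
    refine continuousOn_finsetSum _ fun j hj => ?_
    have hlt := mem_lessLoaded.1 hj
    exact (continuousOn_mixRatio (hm j) (hm k) hlt).comp
      ((continuousOn_xInv (hm j) (hm k) hlt).mono fun y hy => hsub y hy j hj)
      fun y hy => xInv_nonneg hlt (hsub y hy j hj)
  obtain ⟨y, hy, hFy⟩ := intermediate_value_Icc hY0 hcont
    (by rw [F_lessLoaded_zero hm]; exact ⟨zero_le_one, hFY⟩)
  exact ⟨y, hsub y hy, hFy⟩

theorem existsUnique_isEquilibrium (hm : ∀ i, μ i ∈ E.means)
    (hne : (lessLoaded μ k).Nonempty) : ∃! y, IsEquilibrium E μ k y := by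
  obtain ⟨y, hy⟩ := exists_isEquilibrium hm hne
  refine ⟨y, hy, fun z hz => ?_⟩
  rcases lt_trichotomy z y with h | h | h
  · exact absurd (F_lt_F hm hne hz.1 hy.1 h) (by rw [hz.2, hy.2]; exact lt_irrefl _)
  · exact h
  · exact absurd (F_lt_F hm hne hy.1 hz.1 h) (by rw [hz.2, hy.2]; exact lt_irrefl _)

theorem isEquilibrium_yStar (hm : ∀ i, μ i ∈ E.means) (hne : (lessLoaded μ k).Nonempty) :
    IsEquilibrium E μ k (yStar E μ k) :=
  Classical.epsilon_spec (exists_isEquilibrium hm hne)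

theorem yStar_pos (hm : ∀ i, μ i ∈ E.means) (hne : (lessLoaded μ k).Nonempty) :
    0 < yStar E μ k := by
  have h := isEquilibrium_yStar hm hne
  obtain ⟨i, hi⟩ := hne
  have h1 := h.1 i hi
  rw [gRange_eq (hm i) (hm k) (mem_lessLoaded.1 hi)] at h1
  refine h1.1.lt_of_ne fun h0 => ?_
  have h2 := h.2
  rw [← h0, F_lessLoaded_zero hm] at h2
  exact zero_ne_one h2

theorem zStar_pos (hγ : γ ∈ E.means) (hm : ∀ i, μ i ∈ E.means) (hk : μ k < γ) :
    0 < zStar E γ μ k := by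
  have hd := ExpFamily.d_pos (hm k) hγ hk.ne
  unfold zStar
  split_ifs with hne
  · exact lt_min hd (yStar_pos hm hne)
  · exact hd

theorem zStar_le : zStar E γ μ k ≤ E.d (μ k) γ := by
  unfold zStar
  split_ifs
  · exact min_le_left _ _
  · exact le_rfl

theorem zStar_mem_gRange (hγ : γ ∈ E.means) (hm : ∀ i, μ i ∈ E.means) (hk : μ k < γ)
    {j : Fin K} (hj : j ∈ lessLoaded μ k) : zStar E γ μ k ∈ gRange E μ j k := by
  refine mem_gRange_of_le hm (mem_lessLoaded.1 hj)
    ((isEquilibrium_yStar hm ⟨j, hj⟩).1 j hj) (zStar_pos hγ hm hk).le ?_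
  rw [zStar, if_pos ⟨j, hj⟩]
  exact min_le_right _ _

/-- This provides the sign and the complementarity of the multiplier $1-F(z^\star)$: it is
nonnegative, and positive only if the minimum defining $z^\star$ is $d(\mu_k,\gamma)$. -/
theorem F_zStar (hγ : γ ∈ E.means) (hm : ∀ i, μ i ∈ E.means) (hk : μ k < γ) :
    F E μ k (lessLoaded μ k) (zStar E γ μ k) = 1 ∨
      F E μ k (lessLoaded μ k) (zStar E γ μ k) < 1 ∧ zStar E γ μ k = E.d (μ k) γ := by
  by_cases hne : (lessLoaded μ k).Nonempty
  · have hy := isEquilibrium_yStar hm hne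
    rcases le_or_gt (yStar E μ k) (E.d (μ k) γ) with h | h
    · left
      rw [zStar, if_pos hne, min_eq_right h, hy.2]
    · right
      have hz : zStar E γ μ k = E.d (μ k) γ := by rw [zStar, if_pos hne, min_eq_left h.le]
      refine ⟨?_, hz⟩
      rw [← hy.2]
      exact F_lt_F hm hne (fun j hj => zStar_mem_gRange hγ hm hk hj) hy.1 (hz.trans_lt h)
  · right
    refine ⟨?_, by rw [zStar, if_neg hne]⟩
    rw [Finset.not_nonempty_iff_eq_empty.1 hne, F_eq]
    simp

end Equilibrium

/-! ### Linear constraints from limits of alternatives -/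

section Alternatives

open Filter Topology

variable {K : ℕ} {E : ExpFamily} {γ : ℝ} {μ : Fin K → ℝ} {k : Fin K}

theorem succ_mem_correct {ν : Fin K → ℝ} : k.succ ∈ correct γ ν ↔ IsPackingSlice γ ν k := by
  constructor
  · rintro (⟨h, -⟩ | ⟨i, h, hi⟩)
    · exact absurd h (Fin.succ_ne_zero k)
    · rwa [Fin.succ_injective _ h]
  · exact fun h => Or.inr ⟨k, rfl, h⟩

theorem mem_alt_succ {ν : Fin K → ℝ} :
    ν ∈ alt E γ k.succ ↔ ν ∈ instances E γ ∧ ¬ IsPackingSlice γ ν k := by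
  rw [← succ_mem_correct]
  rfl

theorem mem_instances_of_injective {ν : Fin K → ℝ} (hm : ∀ i, ν i ∈ E.means)
    (hγ : ∀ i, ν i ≠ γ) (hinj : Function.Injective ν) : ν ∈ instances E γ :=
  ⟨hm, hγ, fun i j hi hj => hinj (le_antisymm (hj.2 i hi.1) (hi.2 j hj.1))⟩

/-- Two affine functions of $\varepsilon$ with different slopes agree only at $\varepsilon=0$ if
their values there coincide; otherwise they stay apart near $0$. -/
theorem eventually_perturb_ne {a b p q : ℝ} (h : p ≠ q) :
    ∀ᶠ ε in 𝓝[>] (0 : ℝ), a + ε * p ≠ b + ε * q := by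
  by_cases hab : a = b
  · filter_upwards [self_mem_nhdsWithin] with ε hε heq
    have hε' : (0 : ℝ) < ε := hε
    rw [hab, add_right_inj] at heq
    exact h (mul_left_cancel₀ hε'.ne' heq)
  · have hc : ∀ c r : ℝ, Tendsto (fun ε : ℝ => c + ε * r) (𝓝[>] 0) (𝓝 c) := by
      intro c r
      have : Continuous fun ε : ℝ => c + ε * r := by fun_prop
      simpa using (this.tendsto 0).mono_left nhdsWithin_le_nhds
    have := ((hc a p).sub (hc b q)).eventually_ne (sub_ne_zero.2 hab)
    filter_upwards [this] with ε hε heq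
    exact hε (sub_eq_zero.2 heq)

/-- A lower bound on the information cost over the alternatives extends to the load vectors that
are limits of alternatives along a generic direction. -/
theorem le_cost_of_forall_alt (hm : ∀ i, μ i ∈ E.means) {w : Fin K → ℝ} {r : ℝ}
    (hr : ∀ ν ∈ alt E γ k.succ, r ≤ ∑ i, w i * E.d (μ i) (ν i))
    {ν c : Fin K → ℝ} (hν : ∀ i, ν i ∈ E.means) (hc : Function.Injective c)
    (hc0 : ∀ i, c i ≠ 0)
    (hev : ∀ᶠ ε in 𝓝[>] (0 : ℝ), ¬ IsPackingSlice γ (fun i => ν i + ε * c i) k) :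
    r ≤ ∑ i, w i * E.d (μ i) (ν i) := by
  have hlim : ∀ i, Tendsto (fun ε : ℝ => ν i + ε * c i) (𝓝[>] 0) (𝓝 (ν i)) := by
    intro i
    have : Continuous fun ε : ℝ => ν i + ε * c i := by fun_prop
    simpa using (this.tendsto 0).mono_left nhdsWithin_le_nhds
  have hmem : ∀ᶠ ε in 𝓝[>] (0 : ℝ), ∀ i, ν i + ε * c i ∈ E.means :=
    eventually_all.2 fun i => (hlim i).eventually_mem (ExpFamily.isOpen_means.mem_nhds (hν i))
  -- Nonzero slopes move the loads off $\gamma$ and distinct slopes separate ties, so the perturbed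
  -- vector lies in `instances`.
  have hneγ : ∀ᶠ ε in 𝓝[>] (0 : ℝ), ∀ i, ν i + ε * c i ≠ γ :=
    eventually_all.2 fun i => by
      filter_upwards [eventually_perturb_ne (a := ν i) (b := γ) (hc0 i)] with ε hε
      simpa using hε
  have hinj : ∀ᶠ ε in 𝓝[>] (0 : ℝ), ∀ i j, i ≠ j → ν i + ε * c i ≠ ν j + ε * c j :=
    eventually_all.2 fun i => eventually_all.2 fun j => by
      by_cases hij : i = j
      · simp [hij]
      · filter_upwards [eventually_perturb_ne (a := ν i) (b := ν j) (hc.ne hij)] with ε hε _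
        exact hε
  have hcost : Tendsto (fun ε : ℝ => ∑ i, w i * E.d (μ i) (ν i + ε * c i)) (𝓝[>] 0)
      (𝓝 (∑ i, w i * E.d (μ i) (ν i))) := by
    refine tendsto_finsetSum _ fun i _ => Tendsto.const_mul _ ?_
    exact (((ExpFamily.continuousOn_d (hm i)).continuousAt
      (ExpFamily.isOpen_means.mem_nhds (hν i))).tendsto).comp (hlim i)
  refine ge_of_tendsto hcost ?_
  filter_upwards [hmem, hneγ, hinj, hev] with ε h1 h2 h3 h4
  refine hr _ (mem_alt_succ.2 ⟨mem_instances_of_injective h1 h2 fun i j hij => ?_, h4⟩)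
  by_contra hne
  exact h3 i j hne hij

/-- The slopes $s(i+1)$ serve as the generic directions; the shift by one keeps slope `0` nonzero,
and the sign of $s$ is chosen in each application. -/
theorem injective_mul_cast_add_one {s : ℝ} (hs : s ≠ 0) :
    Function.Injective fun i : Fin K => s * ((i : ℕ) + 1 : ℝ) := by
  intro i j h
  have := mul_left_cancel₀ hs h
  exact Fin.ext (by exact_mod_cast add_right_cancel this)

theorem mul_cast_add_one_ne_zero {s : ℝ} (hs : s ≠ 0) (i : Fin K) :
    s * ((i : ℕ) + 1 : ℝ) ≠ 0 := mul_ne_zero hs (by positivity)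

theorem sum_mul_d_update (hm : ∀ i, μ i ∈ E.means) (w : Fin K → ℝ) (i : Fin K) (m : ℝ) :
    ∑ l, w l * E.d (μ l) (Function.update μ i m l) = w i * E.d (μ i) m := by
  rw [Finset.sum_eq_single i]
  · simp
  · intro l _ hl
    rw [Function.update_of_ne hl, ExpFamily.d_self (hm l), mul_zero]
  · simp

theorem update_mem_means (hm : ∀ i, μ i ∈ E.means) {m : ℝ} (h : m ∈ E.means) (i l : Fin K) :
    Function.update μ i m l ∈ E.means := by
  by_cases hl : l = i
  · simpa [hl] using h
  · rw [Function.update_of_ne hl]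
    exact hm l

theorem le_mul_d_packing (hγ : γ ∈ E.means) (hm : ∀ i, μ i ∈ E.means) {w : Fin K → ℝ} {r : ℝ}
    (hr : ∀ ν ∈ alt E γ k.succ, r ≤ ∑ i, w i * E.d (μ i) (ν i)) :
    r ≤ w k * E.d (μ k) γ := by
  rw [← sum_mul_d_update hm w k γ]
  -- Positive slopes push the load of `k` from $\gamma$ upwards, so that `k` becomes unavailable.
  refine le_cost_of_forall_alt hm hr (update_mem_means hm hγ k)
    (injective_mul_cast_add_one one_ne_zero) (mul_cast_add_one_ne_zero one_ne_zero) ?_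
  filter_upwards [self_mem_nhdsWithin] with ε hε hp
  have hε' : (0 : ℝ) < ε := hε
  have := hp.1
  simp only [Function.update_self, one_mul] at this
  have h2 : 0 < ε * ((k : ℕ) + 1 : ℝ) := by positivity
  linarith

theorem le_mul_d_unavailable (hγ : γ ∈ E.means) (hm : ∀ i, μ i ∈ E.means) (hk : μ k < γ)
    {w : Fin K → ℝ} {r : ℝ}
    (hr : ∀ ν ∈ alt E γ k.succ, r ≤ ∑ i, w i * E.d (μ i) (ν i)) {j : Fin K} (hj : γ < μ j) :
    r ≤ w j * E.d (μ j) γ := by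
  have hkj : k ≠ j := fun h => (hk.trans hj).ne (by rw [h])
  rw [← sum_mul_d_update hm w j γ]
  -- Negative slopes push the load of `j` just below $\gamma$: slice `j` becomes available and is
  -- more loaded than `k`.
  refine le_cost_of_forall_alt hm hr (update_mem_means hm hγ j)
    (injective_mul_cast_add_one (neg_ne_zero.2 one_ne_zero))
    (mul_cast_add_one_ne_zero (neg_ne_zero.2 one_ne_zero)) ?_
  have hlim : Tendsto (fun ε : ℝ => (γ + ε * (-1 * ((j : ℕ) + 1))) -
      (μ k + ε * (-1 * ((k : ℕ) + 1)))) (𝓝[>] 0) (𝓝 (γ - μ k)) := by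
    have : Continuous fun ε : ℝ => (γ + ε * (-1 * ((j : ℕ) + 1))) -
      (μ k + ε * (-1 * ((k : ℕ) + 1))) := by fun_prop
    simpa using (this.tendsto 0).mono_left nhdsWithin_le_nhds
  filter_upwards [self_mem_nhdsWithin, hlim.eventually_const_lt (sub_pos.2 hk)] with ε hε h1 hp
  have hε' : (0 : ℝ) < ε := hε
  have h2 : 0 < ε * ((j : ℕ) + 1 : ℝ) := by positivity
  have := hp.2 j (by simp only [Function.update_self]; linarith)
  simp only [Function.update_self, Function.update_of_ne hkj] at this
  linarith

theorem le_mul_d_add_mul_d (hm : ∀ i, μ i ∈ E.means) {w : Fin K → ℝ} {r : ℝ}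
    (hr : ∀ ν ∈ alt E γ k.succ, r ≤ ∑ i, w i * E.d (μ i) (ν i)) {j : Fin K} (hjk : j ≠ k) {m : ℝ}
    (hmm : m ∈ E.means) (hmγ : m < γ) :
    r ≤ w k * E.d (μ k) m + w j * E.d (μ j) m := by
  set ν := Function.update (Function.update μ k m) j m with hν
  have hνj : ν j = m := by simp [hν]
  have hνk : ν k = m := by simp [hν, Function.update_of_ne hjk.symm]
  have hνl : ∀ l, l ≠ k ∧ l ≠ j → ν l = μ l := fun l hl => by
    simp [hν, Function.update_of_ne hl.1, Function.update_of_ne hl.2]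
  have hsum : ∑ i, w i * E.d (μ i) (ν i) = w k * E.d (μ k) m + w j * E.d (μ j) m := by
    rw [Finset.sum_eq_add k j hjk.symm]
    · rw [hνj, hνk]
    · intro l _ hl
      rw [hνl l hl, ExpFamily.d_self (hm l), mul_zero]
    · simp
    · simp
  -- The sign of `s` gives `j` the larger slope, so `j` overtakes `k` from the common load `m` while
  -- staying below $\gamma$.
  obtain ⟨s, hs, hsjk⟩ : ∃ s : ℝ, s ≠ 0 ∧ s * ((k : ℕ) + 1) < s * ((j : ℕ) + 1) := by
    rcases lt_or_gt_of_ne hjk with h | h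
    · have : ((j : ℕ) : ℝ) < (k : ℕ) := by exact_mod_cast h
      exact ⟨-1, by norm_num, by linarith⟩
    · have : ((k : ℕ) : ℝ) < (j : ℕ) := by exact_mod_cast h
      exact ⟨1, by norm_num, by linarith⟩
  rw [← hsum]
  refine le_cost_of_forall_alt hm hr (fun l => ?_) (injective_mul_cast_add_one hs)
    (mul_cast_add_one_ne_zero hs) ?_
  · by_cases h : l ≠ k ∧ l ≠ j
    · rw [hνl l h]
      exact hm l
    · rcases not_and_or.1 h with h | h
      · rw [not_not.1 h, hνk]
        exact hmm
      · rw [not_not.1 h, hνj]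
        exact hmm
  · have hlim : Tendsto (fun ε : ℝ => m + ε * (s * ((j : ℕ) + 1))) (𝓝[>] 0) (𝓝 m) := by
      have : Continuous fun ε : ℝ => m + ε * (s * ((j : ℕ) + 1)) := by fun_prop
      simpa using (this.tendsto 0).mono_left nhdsWithin_le_nhds
    filter_upwards [self_mem_nhdsWithin, hlim.eventually_lt_const hmγ] with ε hε h1 hp
    have hε' : (0 : ℝ) < ε := hε
    have := hp.2 j (by simpa only [hνj] using h1)
    simp only [hνj, hνk] at this
    have := mul_lt_mul_of_pos_left hsjk hε'
    linarith

end Alternatives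

/-! ### Linear programming duality and the optimal proportions -/

section Duality

variable {K : ℕ} {E : ExpFamily} {γ : ℝ} {μ : Fin K → ℝ} {k : Fin K}

theorem filter_lt_threshold (hμ : μ ∈ instances E γ) (hk : IsPackingSlice γ μ k) :
    ({j | μ j < γ} : Finset (Fin K)) = insert k (lessLoaded μ k) := by
  ext j
  simp only [Finset.mem_filter, Finset.mem_univ, true_and, Finset.mem_insert, mem_lessLoaded]
  constructor
  · intro h
    rcases (hk.2 j h).eq_or_lt with he | hlt
    · left
      refine hμ.2.2 j k ⟨h, fun i hi => ?_⟩ hk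
      rw [he]
      exact hk.2 i hi
    · exact Or.inr hlt
  · rintro (rfl | h)
    · exact hk.1
    · exact h.trans hk.1

/-- No load lies above $\mu_k$ and at or below $\gamma$, by maximality of `k` and since no load
equals $\gamma$. -/
theorem lt_iff_threshold_lt (hμ : μ ∈ instances E γ) (hk : IsPackingSlice γ μ k) (j : Fin K) :
    μ k < μ j ↔ γ < μ j := by
  refine ⟨fun h => ?_, fun h => hk.1.trans h⟩
  by_contra hn
  exact absurd (hk.2 j ((not_lt.1 hn).lt_of_ne (hμ.2.1 j))) (not_le.2 h)

theorem not_mem_lessLoaded_self : k ∉ lessLoaded μ k := by simp [mem_lessLoaded]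

theorem sum_filter_lt_threshold (hμ : μ ∈ instances E γ) (hk : IsPackingSlice γ μ k)
    (f : Fin K → ℝ) : ∑ j with μ j < γ, f j = f k + ∑ j ∈ lessLoaded μ k, f j := by
  rw [filter_lt_threshold hμ hk, Finset.sum_insert not_mem_lessLoaded_self]

theorem sum_eq_sum_unavailable_add (hμ : μ ∈ instances E γ) (hk : IsPackingSlice γ μ k)
    (f : Fin K → ℝ) :
    ∑ j, f j = ∑ j with γ < μ j, f j + (f k + ∑ j ∈ lessLoaded μ k, f j) := by
  rw [← sum_filter_lt_threshold hμ hk,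
    ← Finset.sum_filter_add_sum_filter_not Finset.univ (fun j => γ < μ j)]
  congr 2
  ext j
  simp only [Finset.mem_filter, Finset.mem_univ, true_and, not_lt]
  exact ⟨fun h => h.lt_of_ne (hμ.2.1 j), fun h => h.le⟩

/-- The multiple of slice `j`'s measurements per measurement of slice `k` at the optimum. -/
def xStar (E : ExpFamily) (γ : ℝ) (μ : Fin K → ℝ) (k j : Fin K) : ℝ :=
  xInv E μ j k (zStar E γ μ k)

/-- The load at which the least costly alternative confuses the slices `j` and `k`. -/
def mStar (E : ExpFamily) (γ : ℝ) (μ : Fin K → ℝ) (k j : Fin K) : ℝ :=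
  mix μ j k (xStar E γ μ k j)

theorem T2_eq (hμ : μ ∈ instances E γ) (hk : IsPackingSlice γ μ k) :
    T2 E γ μ k = ∑ j with γ < μ j, (E.d (μ j) γ)⁻¹ +
      1 / zStar E γ μ k * (1 + ∑ j ∈ lessLoaded μ k, xStar E γ μ k j) := by
  rw [T2, sum_filter_lt_threshold hμ hk, xInv_self]
  congr 2
  ext j
  simp only [Finset.mem_filter, Finset.mem_univ, true_and]
  exact lt_iff_threshold_lt hμ hk j

theorem wStar_unavailable {j : Fin K} (hj : γ < μ j) :
    wStar E γ μ k j = (T2 E γ μ k)⁻¹ / E.d (μ j) γ := by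
  rw [wStar, if_neg hj.not_gt, if_pos hj]
  ring

theorem wStar_packing (hk : IsPackingSlice γ μ k) :
    wStar E γ μ k k = (T2 E γ μ k)⁻¹ / zStar E γ μ k := by
  rw [wStar, if_pos hk.1, if_neg hk.1.not_gt, xInv_self]
  ring

theorem wStar_lessLoaded (hk : IsPackingSlice γ μ k) {j : Fin K} (hj : j ∈ lessLoaded μ k) :
    wStar E γ μ k j = (T2 E γ μ k)⁻¹ / zStar E γ μ k * xStar E γ μ k j := by
  have : μ j < γ := (mem_lessLoaded.1 hj).trans hk.1
  rw [wStar, if_pos this, if_neg this.not_gt, xStar]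
  ring

theorem trichotomy_slices (hμ : μ ∈ instances E γ) (hk : IsPackingSlice γ μ k) (j : Fin K) :
    γ < μ j ∨ j = k ∨ j ∈ lessLoaded μ k := by
  rcases lt_or_gt_of_ne (hμ.2.1 j) with h | h
  · right
    have : j ∈ ({j | μ j < γ} : Finset (Fin K)) := by simpa using h
    rw [filter_lt_threshold hμ hk] at this
    simpa using this
  · exact Or.inl h

theorem rate_le_cost {w : Fin K → ℝ} (hw : ∀ i, 0 ≤ w i) {ν : Fin K → ℝ}
    (hν : ν ∈ alt E γ k.succ) : rate E γ μ k.succ w ≤ ∑ i, w i * E.d (μ i) (ν i) := by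
  refine csInf_le ⟨0, ?_⟩ (mem_image_of_mem _ hν)
  rintro _ ⟨ν', -, rfl⟩
  exact Finset.sum_nonneg fun i _ => mul_nonneg (hw i) (ExpFamily.d_nonneg _ _)

theorem xStar_nonneg (hγ : γ ∈ E.means) (hμ : μ ∈ instances E γ)
    (hk : IsPackingSlice γ μ k) {j : Fin K} (hj : j ∈ lessLoaded μ k) : 0 ≤ xStar E γ μ k j :=
  xInv_nonneg (mem_lessLoaded.1 hj) (zStar_mem_gRange hγ hμ.1 hk.1 hj)

theorem zStar_eq_g (hγ : γ ∈ E.means) (hμ : μ ∈ instances E γ)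
    (hk : IsPackingSlice γ μ k) {j : Fin K} (hj : j ∈ lessLoaded μ k) :
    zStar E γ μ k = g E μ j k (xStar E γ μ k j) :=
  (g_xInv (mem_lessLoaded.1 hj) (zStar_mem_gRange hγ hμ.1 hk.1 hj)).symm

theorem zStar_eq (hγ : γ ∈ E.means) (hμ : μ ∈ instances E γ)
    (hk : IsPackingSlice γ μ k) {j : Fin K} (hj : j ∈ lessLoaded μ k) :
    zStar E γ μ k = E.d (μ k) (mStar E γ μ k j) + xStar E γ μ k j * E.d (μ j) (mStar E γ μ k j) :=
  zStar_eq_g hγ hμ hk hj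

theorem d_mStar_pos (hγ : γ ∈ E.means) (hμ : μ ∈ instances E γ)
    (hk : IsPackingSlice γ μ k) {j : Fin K} (hj : j ∈ lessLoaded μ k) :
    0 < E.d (μ j) (mStar E γ μ k j) :=
  d_mix_pos (hμ.1 j) (hμ.1 k) (mem_lessLoaded.1 hj) (xStar_nonneg hγ hμ hk hj)

theorem mStar_mem_means (hγ : γ ∈ E.means) (hμ : μ ∈ instances E γ)
    (hk : IsPackingSlice γ μ k) {j : Fin K} (hj : j ∈ lessLoaded μ k) : mStar E γ μ k j ∈ E.means :=
  mix_mem_means (hμ.1 j) (hμ.1 k) (mem_lessLoaded.1 hj) (xStar_nonneg hγ hμ hk hj)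

theorem mStar_lt (hγ : γ ∈ E.means) (hμ : μ ∈ instances E γ)
    (hk : IsPackingSlice γ μ k) {j : Fin K} (hj : j ∈ lessLoaded μ k) : mStar E γ μ k j < γ :=
  (mix_le (mem_lessLoaded.1 hj) (xStar_nonneg hγ hμ hk hj)).trans_lt hk.1

theorem T2_pos (hγ : γ ∈ E.means) (hμ : μ ∈ instances E γ)
    (hk : IsPackingSlice γ μ k) : 0 < T2 E γ μ k := by
  rw [T2_eq hμ hk]
  have hz := zStar_pos hγ hμ.1 hk.1
  have h1 : 0 ≤ ∑ j with γ < μ j, (E.d (μ j) γ)⁻¹ :=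
    Finset.sum_nonneg fun j _ => inv_nonneg.2 (ExpFamily.d_nonneg _ _)
  have h2 : 0 ≤ ∑ j ∈ lessLoaded μ k, xStar E γ μ k j :=
    Finset.sum_nonneg fun j hj => xStar_nonneg hγ hμ hk hj
  positivity

/-- The excess of the total weight over `T₂(μ) r` is a combination of the slacks of the
constraints, with nonnegative multipliers. -/
theorem sum_sub_T2_mul (hγ : γ ∈ E.means) (hμ : μ ∈ instances E γ)
    (hk : IsPackingSlice γ μ k) (w : Fin K → ℝ) (r : ℝ) :
    ∑ j, w j - T2 E γ μ k * r =
      ∑ j with γ < μ j, (w j - r / E.d (μ j) γ) +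
      (∑ j ∈ lessLoaded μ k, (w k * E.d (μ k) (mStar E γ μ k j) +
        w j * E.d (μ j) (mStar E γ μ k j) - r) / E.d (μ j) (mStar E γ μ k j) +
      (1 - F E μ k (lessLoaded μ k) (zStar E γ μ k)) * (w k - r / zStar E γ μ k)) := by
  have hz := (zStar_pos hγ hμ.1 hk.1).ne'
  rw [sum_eq_sum_unavailable_add hμ hk, T2_eq hμ hk]
  have h1 : ∑ j with γ < μ j, (w j - r / E.d (μ j) γ) =
      ∑ j with γ < μ j, w j - (∑ j with γ < μ j, (E.d (μ j) γ)⁻¹) * r := by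
    rw [Finset.sum_sub_distrib, Finset.sum_mul]
    congr 1
    exact Finset.sum_congr rfl fun j _ => by rw [div_eq_inv_mul]
  -- With $A_j,B_j$ the divergences of $\mu_k,\mu_j$ from `mStar`, the relation $z^\star=A_j+x_jB_j$
  -- turns $r/B_j$ into $(r/z^\star)(A_j/B_j+x_j)$.
  have h2 : ∑ j ∈ lessLoaded μ k, (w k * E.d (μ k) (mStar E γ μ k j) +
        w j * E.d (μ j) (mStar E γ μ k j) - r) / E.d (μ j) (mStar E γ μ k j) =
      ∑ j ∈ lessLoaded μ k, (w j - r / zStar E γ μ k * xStar E γ μ k j +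
        (w k - r / zStar E γ μ k) *
          (E.d (μ k) (mStar E γ μ k j) / E.d (μ j) (mStar E γ μ k j))) := by
    refine Finset.sum_congr rfl fun j hj => ?_
    have hb := (d_mStar_pos hγ hμ hk hj).ne'
    have hzj := zStar_eq hγ hμ hk hj
    field_simp
    linear_combination (-r) * hzj
  rw [h1, h2, Finset.sum_add_distrib, Finset.sum_sub_distrib, ← Finset.mul_sum, ← Finset.mul_sum]
  -- The ratios sum to `F`, so the pair slacks contribute `F` copies of $w_k-r/z^\star$ and the last
  -- term supplies the missing $1-F$.
  have h3 : ∑ j ∈ lessLoaded μ k, E.d (μ k) (mStar E γ μ k j) / E.d (μ j) (mStar E γ μ k j) =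
      F E μ k (lessLoaded μ k) (zStar E γ μ k) := rfl
  rw [h3]
  ring

theorem slack_unavailable_nonneg (hγ : γ ∈ E.means) (hμ : μ ∈ instances E γ)
    (hk : IsPackingSlice γ μ k) {w : Fin K → ℝ} {r : ℝ}
    (hr : ∀ ν ∈ alt E γ k.succ, r ≤ ∑ i, w i * E.d (μ i) (ν i)) {j : Fin K} (hj : γ < μ j) :
    0 ≤ w j - r / E.d (μ j) γ := by
  rw [sub_nonneg, div_le_iff₀ (ExpFamily.d_pos (hμ.1 j) hγ hj.ne')]
  exact le_mul_d_unavailable hγ hμ.1 hk.1 hr hj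

theorem slack_lessLoaded_nonneg (hγ : γ ∈ E.means) (hμ : μ ∈ instances E γ)
    (hk : IsPackingSlice γ μ k) {w : Fin K → ℝ} {r : ℝ}
    (hr : ∀ ν ∈ alt E γ k.succ, r ≤ ∑ i, w i * E.d (μ i) (ν i)) {j : Fin K}
    (hj : j ∈ lessLoaded μ k) :
    0 ≤ (w k * E.d (μ k) (mStar E γ μ k j) + w j * E.d (μ j) (mStar E γ μ k j) - r) /
      E.d (μ j) (mStar E γ μ k j) := by
  refine div_nonneg (sub_nonneg.2 ?_) (ExpFamily.d_nonneg _ _)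
  exact le_mul_d_add_mul_d hμ.1 hr (fun h => (mem_lessLoaded.1 hj).ne (by rw [h]))
    (mStar_mem_means hγ hμ hk hj) (mStar_lt hγ hμ hk hj)

/-- The second factor has no known sign when $F=1$, but then the product vanishes; otherwise
$z^\star=d(\mu_k,\gamma)$ and the threshold constraint on `k` applies. -/
theorem slack_packing_nonneg (hγ : γ ∈ E.means) (hμ : μ ∈ instances E γ)
    (hk : IsPackingSlice γ μ k) {w : Fin K → ℝ} {r : ℝ}
    (hr : ∀ ν ∈ alt E γ k.succ, r ≤ ∑ i, w i * E.d (μ i) (ν i)) :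
    0 ≤ (1 - F E μ k (lessLoaded μ k) (zStar E γ μ k)) * (w k - r / zStar E γ μ k) := by
  rcases F_zStar hγ hμ.1 hk.1 with h | ⟨h, hz⟩
  · rw [h, sub_self, zero_mul]
  · refine mul_nonneg (sub_pos.2 h).le ?_
    rw [sub_nonneg, div_le_iff₀ (zStar_pos hγ hμ.1 hk.1), hz]
    exact le_mul_d_packing hγ hμ.1 hr

/-- Weak duality: weights of information rate at least `r` have total weight at least
`T₂(μ) r`. -/
theorem T2_mul_le_sum (hγ : γ ∈ E.means) (hμ : μ ∈ instances E γ)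
    (hk : IsPackingSlice γ μ k) {w : Fin K → ℝ} {r : ℝ}
    (hr : ∀ ν ∈ alt E γ k.succ, r ≤ ∑ i, w i * E.d (μ i) (ν i)) :
    T2 E γ μ k * r ≤ ∑ j, w j := by
  rw [← sub_nonneg, sum_sub_T2_mul hγ hμ hk]
  refine add_nonneg (Finset.sum_nonneg fun j hj => ?_)
    (add_nonneg (Finset.sum_nonneg fun j hj => ?_) (slack_packing_nonneg hγ hμ hk hr))
  · exact slack_unavailable_nonneg hγ hμ hk hr (by simpa using hj)
  · exact slack_lessLoaded_nonneg hγ hμ hk hr hj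

/-- Complementary slackness: tight weights are determined by their information rate. -/
theorem eq_of_sum_eq_T2_mul (hγ : γ ∈ E.means) (hμ : μ ∈ instances E γ)
    (hk : IsPackingSlice γ μ k) {w : Fin K → ℝ} (hw : ∀ i, 0 ≤ w i) {r : ℝ} (hr0 : 0 < r)
    (hr : ∀ ν ∈ alt E γ k.succ, r ≤ ∑ i, w i * E.d (μ i) (ν i))
    (hsum : ∑ j, w j = T2 E γ μ k * r) :
    (∀ j, γ < μ j → w j = r / E.d (μ j) γ) ∧ w k = r / zStar E γ μ k ∧
      ∀ j ∈ lessLoaded μ k, w j = r / zStar E γ μ k * xStar E γ μ k j := by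
  have hz := zStar_pos hγ hμ.1 hk.1
  have hid := sum_sub_T2_mul hγ hμ hk w r
  rw [hsum, sub_self] at hid
  have hA : ∀ j ∈ ({j | γ < μ j} : Finset (Fin K)), 0 ≤ w j - r / E.d (μ j) γ := fun j hj =>
    slack_unavailable_nonneg hγ hμ hk hr (by simpa using hj)
  have hB : ∀ j ∈ lessLoaded μ k, 0 ≤ (w k * E.d (μ k) (mStar E γ μ k j) +
      w j * E.d (μ j) (mStar E γ μ k j) - r) / E.d (μ j) (mStar E γ μ k j) := fun j hj =>
    slack_lessLoaded_nonneg hγ hμ hk hr hj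
  have hC := slack_packing_nonneg hγ hμ hk hr
  have hA' := Finset.sum_nonneg hA
  have hB' := Finset.sum_nonneg hB
  -- Nonnegative terms with sum zero all vanish.
  have hA0 := (Finset.sum_eq_zero_iff_of_nonneg hA).1 (by linarith)
  have hB0 := (Finset.sum_eq_zero_iff_of_nonneg hB).1 (by linarith)
  have hC0 : (1 - F E μ k (lessLoaded μ k) (zStar E γ μ k)) * (w k - r / zStar E γ μ k) = 0 := by
    linarith
  have hS : ∀ j ∈ lessLoaded μ k, w k = r / zStar E γ μ k ∧ w j = xStar E γ μ k j * w k := by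
    intro j hj
    have hlt := mem_lessLoaded.1 hj
    have hjk : j ≠ k := fun h => hlt.ne (by rw [h])
    have hx := xStar_nonneg hγ hμ hk hj
    have htight : w k * E.d (μ k) (mStar E γ μ k j) + w j * E.d (μ j) (mStar E γ μ k j) = r := by
      rcases div_eq_zero_iff.1 (hB0 j hj) with h | h
      · linarith
      · exact absurd h (d_mStar_pos hγ hμ hk hj).ne'
    have hpos : 0 < w k + w j := by
      refine (add_nonneg (hw k) (hw j)).lt_of_ne fun h => ?_
      have h1 : w k = 0 := by linarith [hw k, hw j]
      have h2 : w j = 0 := by linarith [hw k, hw j]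
      rw [h1, h2] at htight
      linarith
    -- The mean `c` of $\mu_k,\mu_j$ with weights $w_k,w_j$ minimizes the pair's cost, which is
    -- still at least `r` at `c` and equals `r` at `mStar`. Hence `c` is `mStar`.
    set c := (w k * μ k + w j * μ j) / (w k + w j) with hc
    have hcmul : w k * μ k + w j * μ j = (w k + w j) * c := by
      rw [hc]
      field_simp
    have hcIcc : c ∈ Icc (μ j) (μ k) := by
      constructor
      · rw [hc, le_div_iff₀ hpos]
        nlinarith [hw k]
      · rw [hc, div_le_iff₀ hpos]
        nlinarith [hw j]
    have hcm : c ∈ E.means := ExpFamily.ordConnected_means.out (hμ.1 j) (hμ.1 k) hcIcc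
    have hle := le_mul_d_add_mul_d hμ.1 hr hjk hcm (hcIcc.2.trans_lt hk.1)
    have hmm := mStar_mem_means hγ hμ hk hj
    have hcomp := ExpFamily.mul_d_add_mul_d (hμ.1 k) (hμ.1 j) hcm hmm hcmul
    have hceq : c = mStar E γ μ k j := by
      by_contra hne
      have := mul_pos hpos (ExpFamily.d_pos hcm hmm hne)
      linarith
    have hmix : 1 * μ k + xStar E γ μ k j * μ j = (1 + xStar E γ μ k j) * mStar E γ μ k j :=
      one_add_mul_mix hx
    have hwj : w j = xStar E γ μ k j * w k := by
      rw [hceq] at hcmul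
      -- Since $\mu_j\ne\mu_k$, the mean determines the ratio of the weights.
      have : (μ k - μ j) * (xStar E γ μ k j * w k - w j) = 0 := by
        linear_combination (1 + xStar E γ μ k j) * hcmul - (w k + w j) * hmix
      rcases mul_eq_zero.1 this with h | h
      · linarith
      · linarith
    refine ⟨?_, hwj⟩
    rw [eq_div_iff hz.ne', zStar_eq hγ hμ hk hj, ← htight, hwj]
    ring
  have hwk : w k = r / zStar E γ μ k := by
    by_cases hne : (lessLoaded μ k).Nonempty
    · exact (hS _ hne.choose_spec).1
    · rw [Finset.not_nonempty_iff_eq_empty.1 hne, F_eq] at hC0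
      simp only [Finset.sum_empty, sub_zero, one_mul] at hC0
      linarith
  refine ⟨fun j hj => ?_, hwk, fun j hj => ?_⟩
  · have := hA0 j (by simpa using hj)
    linarith
  · rw [(hS j hj).2, hwk, mul_comm]

theorem wStar_nonneg (hγ : γ ∈ E.means) (hμ : μ ∈ instances E γ)
    (hk : IsPackingSlice γ μ k) (j : Fin K) : 0 ≤ wStar E γ μ k j := by
  have hT := T2_pos hγ hμ hk
  have hz := zStar_pos hγ hμ.1 hk.1
  rcases trichotomy_slices hμ hk j with h | rfl | h
  · rw [wStar_unavailable h]
    exact div_nonneg (inv_nonneg.2 hT.le) (ExpFamily.d_nonneg _ _)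
  · rw [wStar_packing hk]
    positivity
  · rw [wStar_lessLoaded hk h]
    have := xStar_nonneg hγ hμ hk h
    positivity

theorem sum_wStar (hγ : γ ∈ E.means) (hμ : μ ∈ instances E γ)
    (hk : IsPackingSlice γ μ k) : ∑ j, wStar E γ μ k j = 1 := by
  have hT := (T2_pos hγ hμ hk).ne'
  have hz := (zStar_pos hγ hμ.1 hk.1).ne'
  have h1 : ∑ j with γ < μ j, wStar E γ μ k j =
      (T2 E γ μ k)⁻¹ * ∑ j with γ < μ j, (E.d (μ j) γ)⁻¹ := by
    rw [Finset.mul_sum]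
    refine Finset.sum_congr rfl fun j hj => ?_
    rw [wStar_unavailable (by simpa using hj), div_eq_mul_inv]
  have h2 : ∑ j ∈ lessLoaded μ k, wStar E γ μ k j =
      (T2 E γ μ k)⁻¹ / zStar E γ μ k * ∑ j ∈ lessLoaded μ k, xStar E γ μ k j := by
    rw [Finset.mul_sum]
    exact Finset.sum_congr rfl fun j hj => wStar_lessLoaded hk hj
  rw [sum_eq_sum_unavailable_add hμ hk, h1, h2, wStar_packing hk]
  have h3 : (T2 E γ μ k)⁻¹ * T2 E γ μ k = 1 := inv_mul_cancel₀ hT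
  nth_rw 2 [T2_eq hμ hk] at h3
  rw [← h3]
  ring

theorem wStar_mem_stdSimplex (hγ : γ ∈ E.means) (hμ : μ ∈ instances E γ)
    (hk : IsPackingSlice γ μ k) : wStar E γ μ k ∈ stdSimplex ℝ (Fin K) :=
  ⟨wStar_nonneg hγ hμ hk, sum_wStar hγ hμ hk⟩

theorem zStar_le_of_lt (hγ : γ ∈ E.means) (hμ : μ ∈ instances E γ)
    (hk : IsPackingSlice γ μ k) {j : Fin K} (hj : j ∈ lessLoaded μ k) {a b : ℝ} (ha : a ∈ E.means)
    (hb : b ∈ E.means) (hab : a < b) :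
    zStar E γ μ k ≤ E.d (μ k) a + xStar E γ μ k j * E.d (μ j) b := by
  have hlt := mem_lessLoaded.1 hj
  have hx := xStar_nonneg hγ hμ hk hj
  -- The common load `m` is `a` clamped to $[\mu_j,\mu_k]$; this increases neither divergence, and
  -- `g_le` then applies.
  suffices h : ∃ m ∈ E.means, E.d (μ k) m ≤ E.d (μ k) a ∧ E.d (μ j) m ≤ E.d (μ j) b by
    obtain ⟨m, hm, h1, h2⟩ := h
    rw [zStar_eq_g hγ hμ hk hj]
    refine (g_le (hμ.1 j) (hμ.1 k) hlt hx hm).trans ?_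
    gcongr
  rcases le_or_gt (μ k) a with h | h
  · refine ⟨μ k, hμ.1 k, ?_, (ExpFamily.d_lt_d_of_lt_of_lt (hμ.1 j) hb hlt (h.trans_lt hab)).le⟩
    rw [ExpFamily.d_self (hμ.1 k)]
    exact ExpFamily.d_nonneg _ _
  · rcases lt_trichotomy (μ j) a with h' | h' | h'
    · exact ⟨a, ha, le_rfl, (ExpFamily.d_lt_d_of_lt_of_lt (hμ.1 j) hb h' hab).le⟩
    · refine ⟨a, ha, le_rfl, ?_⟩
      rw [← h', ExpFamily.d_self (hμ.1 j)]
      exact ExpFamily.d_nonneg _ _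
    · refine ⟨μ j, hμ.1 j, (ExpFamily.d_lt_d_of_gt_of_gt (hμ.1 k) ha hlt h').le, ?_⟩
      rw [ExpFamily.d_self (hμ.1 j)]
      exact ExpFamily.d_nonneg _ _

/-- An alternative either makes `k` unavailable, or puts an available slice above `k`. That slice
was unavailable, and crossing $\gamma$ alone costs enough, or it was less loaded, and the pair costs
at least $z^\star$ times the weight of `k`. -/
theorem inv_T2_le_cost_wStar (hγ : γ ∈ E.means) (hμ : μ ∈ instances E γ)
    (hk : IsPackingSlice γ μ k) {ν : Fin K → ℝ} (hν : ν ∈ alt E γ k.succ) :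
    (T2 E γ μ k)⁻¹ ≤ ∑ i, wStar E γ μ k i * E.d (μ i) (ν i) := by
  obtain ⟨hνi, hνk⟩ := mem_alt_succ.1 hν
  have hT := inv_pos.2 (T2_pos hγ hμ hk)
  have hz := zStar_pos hγ hμ.1 hk.1
  have hterm : ∀ i, 0 ≤ wStar E γ μ k i * E.d (μ i) (ν i) := fun i =>
    mul_nonneg (wStar_nonneg hγ hμ hk i) (ExpFamily.d_nonneg _ _)
  rcases lt_or_gt_of_ne (hνi.2.1 k) with hlt | hgt
  · have : ∃ j, ν j < γ ∧ ν k < ν j := by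
      by_contra! hcon
      exact hνk ⟨hlt, hcon⟩
    obtain ⟨j, hjγ, hkj⟩ := this
    rcases trichotomy_slices hμ hk j with hj | rfl | hj
    · refine le_trans ?_ (Finset.single_le_sum (fun i _ => hterm i) (Finset.mem_univ j))
      have hd := ExpFamily.d_pos (hμ.1 j) hγ hj.ne'
      rw [wStar_unavailable hj, div_mul_eq_mul_div, le_div_iff₀ hd]
      exact mul_le_mul_of_nonneg_left
        (ExpFamily.d_lt_d_of_gt_of_gt (hμ.1 j) (hνi.1 j) hj hjγ).le hT.le
    · exact absurd hkj (lt_irrefl _)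
    · have hjk' := mem_lessLoaded.1 hj
      have hjk : j ≠ k := fun h => hjk'.ne (by rw [h])
      have hx := xStar_nonneg hγ hμ hk hj
      have hpair : wStar E γ μ k k * E.d (μ k) (ν k) + wStar E γ μ k j * E.d (μ j) (ν j) ≤
          ∑ i, wStar E γ μ k i * E.d (μ i) (ν i) := by
        rw [← Finset.sum_pair (f := fun i => wStar E γ μ k i * E.d (μ i) (ν i)) hjk.symm]
        exact Finset.sum_le_sum_of_subset_of_nonneg (Finset.subset_univ _) fun i _ _ => hterm i
      refine le_trans ?_ hpair
      rw [wStar_packing hk, wStar_lessLoaded hk hj]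
      have key : zStar E γ μ k ≤
          E.d (μ k) (ν k) + xStar E γ μ k j * E.d (μ j) (ν j) :=
        zStar_le_of_lt hγ hμ hk hj (hνi.1 k) (hνi.1 j) hkj
      calc (T2 E γ μ k)⁻¹ = (T2 E γ μ k)⁻¹ / zStar E γ μ k * zStar E γ μ k := by field_simp
        _ ≤ (T2 E γ μ k)⁻¹ / zStar E γ μ k *
            (E.d (μ k) (ν k) + xStar E γ μ k j * E.d (μ j) (ν j)) := by gcongr
        _ = _ := by ring
  · refine le_trans ?_ (Finset.single_le_sum (fun i _ => hterm i) (Finset.mem_univ k))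
    rw [wStar_packing hk, div_mul_eq_mul_div, le_div_iff₀ hz]
    exact mul_le_mul_of_nonneg_left (zStar_le.trans
      (ExpFamily.d_lt_d_of_lt_of_lt (hμ.1 k) (hνi.1 k) hk.1 hgt).le) hT.le

/-- Without alternatives the zero weights would satisfy every constraint with $r=1$, against weak
duality. This excludes the default value of `sInf` on the empty set. -/
theorem alt_nonempty (hγ : γ ∈ E.means) (hμ : μ ∈ instances E γ)
    (hk : IsPackingSlice γ μ k) : (alt E γ k.succ).Nonempty := by
  by_contra hne
  have h := T2_mul_le_sum hγ hμ hk (w := 0) (r := 1)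
    fun ν hν => absurd ⟨ν, hν⟩ hne
  have hT := T2_pos hγ hμ hk
  simp only [Pi.zero_apply, Finset.sum_const_zero] at h
  linarith

theorem rate_le_inv_T2 (hγ : γ ∈ E.means) (hμ : μ ∈ instances E γ)
    (hk : IsPackingSlice γ μ k) {w : Fin K → ℝ} (hw : w ∈ stdSimplex ℝ (Fin K)) :
    rate E γ μ k.succ w ≤ (T2 E γ μ k)⁻¹ := by
  have h := T2_mul_le_sum hγ hμ hk (w := w) (r := rate E γ μ k.succ w)
    fun ν hν => rate_le_cost hw.1 hν
  rw [hw.2] at h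
  rw [← one_div, le_div_iff₀ (T2_pos hγ hμ hk)]
  linarith

theorem rate_wStar (hγ : γ ∈ E.means) (hμ : μ ∈ instances E γ)
    (hk : IsPackingSlice γ μ k) : rate E γ μ k.succ (wStar E γ μ k) = (T2 E γ μ k)⁻¹ := by
  refine le_antisymm (rate_le_inv_T2 hγ hμ hk (wStar_mem_stdSimplex hγ hμ hk)) ?_
  refine le_csInf ((alt_nonempty hγ hμ hk).image _) ?_
  rintro _ ⟨ν, hν, rfl⟩
  exact inv_T2_le_cost_wStar hγ hμ hk hν

theorem eq_wStar_of_rate_eq (hγ : γ ∈ E.means) (hμ : μ ∈ instances E γ)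
    (hk : IsPackingSlice γ μ k) {w : Fin K → ℝ} (hw : w ∈ stdSimplex ℝ (Fin K))
    (hr : rate E γ μ k.succ w = (T2 E γ μ k)⁻¹) : w = wStar E γ μ k := by
  have hT := T2_pos hγ hμ hk
  obtain ⟨h1, h2, h3⟩ := eq_of_sum_eq_T2_mul hγ hμ hk hw.1 (inv_pos.2 hT)
    (fun ν hν => hr ▸ rate_le_cost hw.1 hν)
    (by rw [hw.2, mul_inv_cancel₀ hT.ne'])
  ext j
  rcases trichotomy_slices hμ hk j with h | rfl | h
  · rw [h1 j h, wStar_unavailable h]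
  · rw [h2, wStar_packing hk]
  · rw [h3 j h, wStar_lessLoaded hk h]

theorem setOf_isMaxOn_rate (hγ : γ ∈ E.means) (hμ : μ ∈ instances E γ)
    (hk : IsPackingSlice γ μ k) : {w : Fin K → ℝ | w ∈ stdSimplex ℝ (Fin K) ∧
    IsMaxOn (rate E γ μ k.succ) (stdSimplex ℝ (Fin K)) w} = {wStar E γ μ k} := by
  ext w
  simp only [mem_ofPred_eq, mem_singleton_iff]
  constructor
  · rintro ⟨hw, hmax⟩
    refine eq_wStar_of_rate_eq hγ hμ hk hw (le_antisymm (rate_le_inv_T2 hγ hμ hk hw) ?_)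
    rw [← rate_wStar hγ hμ hk]
    exact hmax (wStar_mem_stdSimplex hγ hμ hk)
  · rintro rfl
    refine ⟨wStar_mem_stdSimplex hγ hμ hk, fun w hw => ?_⟩
    rw [mem_ofPred_eq, rate_wStar hγ hμ hk]
    exact rate_le_inv_T2 hγ hμ hk hw

end Duality

/-! ### Independence of the next slot from the past -/

section Independence

variable {K : ℕ} {E : ExpFamily} {μ : Fin K → ℝ}

theorem isProbabilityMeasure_pi_law (hm : ∀ i, μ i ∈ E.means) :
    IsProbabilityMeasure (Measure.pi fun i => E.law (μ i)) := by
  have := fun i => ExpFamily.isProbabilityMeasure_law (hm i)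
  infer_instance

theorem isProbabilityMeasure_obsLaw (hm : ∀ i, μ i ∈ E.means) :
    IsProbabilityMeasure (obsLaw E μ) := by
  have := isProbabilityMeasure_pi_law hm
  unfold obsLaw
  infer_instance

theorem measurable_obs (t : ℕ) (j : Fin K) : Measurable fun ω : Obs K => ω t j :=
  (measurable_pi_apply j).comp (measurable_pi_apply t)

theorem map_obs_obsLaw (hm : ∀ i, μ i ∈ E.means) (t : ℕ) (j : Fin K) :
    (obsLaw E μ).map (fun ω => ω t j) = E.law (μ j) := by
  have := fun i => ExpFamily.isProbabilityMeasure_law (hm i)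
  have h1 : (obsLaw E μ).map (fun ω => ω t) = Measure.pi fun i => E.law (μ i) :=
    Measure.infinitePi_map_eval _ t
  have h2 : (fun ω : Obs K => ω t j) = (fun x : Fin K → ℝ => x j) ∘ fun ω => ω t := rfl
  rw [h2, ← Measure.map_map (measurable_pi_apply j) (measurable_pi_apply t), h1]
  exact (measurePreserving_eval (fun i => E.law (μ i)) j).map_eq

/-- The σ-algebra of all measurements of slot `t + 1`. -/
@[reducible]
def slotSpace (K : ℕ) (t : ℕ) : MeasurableSpace (Obs K) :=
  MeasurableSpace.comap (fun ω : Obs K => ω t) MeasurableSpace.pi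

/-- Each arm is measurable with respect to an earlier history, hence the strong induction.
Independence of the slots then carries over to the history. -/
theorem history_le_iSup_slotSpace (S : SamplingRule K) (t : ℕ) :
    history S.arm t ≤ ⨆ s ∈ Set.Iio t, slotSpace K s := by
  induction t using Nat.strong_induction_on with
  | _ t ih =>
    refine iSup₂_le fun s hs => ?_
    have harm : Measurable[⨆ s ∈ Set.Iio t, slotSpace K s] (S.arm s) :=
      (S.adapted s).mono ((ih s hs).trans
        (biSup_mono fun i (hi : i < s) => hi.trans hs)) le_rfl
    have hslot : Measurable[⨆ s ∈ Set.Iio t, slotSpace K s] fun ω : Obs K => ω s :=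
      (comap_measurable _).mono (le_iSup₂_of_le s hs le_rfl) le_rfl
    refine sup_le harm.comap_le ?_
    rw [← (inferInstance : BorelSpace ℝ).measurable_eq]
    refine Measurable.comap_le ?_
    exact (measurable_from_prod_countable_left (f := fun p : (Fin K → ℝ) × Fin K => p.1 p.2)
      (fun k => measurable_pi_apply k)).comp (hslot.prodMk harm)

theorem slotSpace_le (t : ℕ) : slotSpace K t ≤ MeasurableSpace.pi :=
  (measurable_pi_apply t).comap_le

theorem indep_history_slotSpace (hm : ∀ i, μ i ∈ E.means) (S : SamplingRule K) (t : ℕ) :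
    Indep (history S.arm t) (slotSpace K t) (obsLaw E μ) := by
  have := isProbabilityMeasure_pi_law hm
  have h : iIndepFun (fun (t : ℕ) (ω : Obs K) => ω t) (obsLaw E μ) :=
    iIndepFun_infinitePi (X := fun _ x => x) fun _ => measurable_id
  have h2 := indep_iSup_of_disjoint (S := Set.Iio t) (T := {t}) (fun i => slotSpace_le i) h
    (by simp)
  refine indep_of_indep_of_le_left (indep_of_indep_of_le_right h2 ?_)
    (history_le_iSup_slotSpace S t)
  exact le_iSup₂_of_le t (mem_singleton t) le_rfl

theorem history_le (S : SamplingRule K) (t : ℕ) : history S.arm t ≤ MeasurableSpace.pi :=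
  S.filtration.le t

theorem measurable_slotSpace_obs (t : ℕ) (j : Fin K) :
    Measurable[slotSpace K t] fun ω : Obs K => ω t j :=
  (measurable_pi_apply j).comp (comap_measurable _)

theorem lintegral_mul_obs (hm : ∀ i, μ i ∈ E.means) (S : SamplingRule K) {t : ℕ}
    {f : Obs K → ℝ≥0∞} (hf : Measurable[history S.arm t] f) {h : ℝ → ℝ≥0∞} (hh : Measurable h)
    (j : Fin K) :
    ∫⁻ ω, f ω * h (ω t j) ∂(obsLaw E μ) =
      (∫⁻ ω, f ω ∂(obsLaw E μ)) * ∫⁻ x, h x ∂(E.law (μ j)) := by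
  rw [← map_obs_obsLaw hm t j, lintegral_map hh (measurable_obs t j)]
  exact lintegral_mul_eq_lintegral_mul_lintegral_of_independent_measurableSpace (history_le S t)
    (slotSpace_le t) (indep_history_slotSpace hm S t) hf (hh.comp (measurable_slotSpace_obs t j))

theorem measurableSet_arm_eq (S : SamplingRule K) (t : ℕ) (j : Fin K) :
    MeasurableSet[history S.arm t] {ω | S.arm t ω = j} :=
  S.adapted t (measurableSet_singleton j)

/-- Integration of a function of the past and of the slice and the value observed next. -/
theorem lintegral_mul_obs_arm (hm : ∀ i, μ i ∈ E.means) (S : SamplingRule K) {t : ℕ}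
    {f : Obs K → ℝ≥0∞} (hf : Measurable[history S.arm t] f) {h : Fin K → ℝ → ℝ≥0∞}
    (hh : ∀ j, Measurable (h j)) :
    ∫⁻ ω, f ω * h (S.arm t ω) (ω t (S.arm t ω)) ∂(obsLaw E μ) =
      ∑ j, (∫⁻ ω in {ω | S.arm t ω = j}, f ω ∂(obsLaw E μ)) * ∫⁻ x, h j x ∂(E.law (μ j)) := by
  have hA := fun j => measurableSet_arm_eq S t j
  have h1 : ∀ ω, f ω * h (S.arm t ω) (ω t (S.arm t ω)) =
      ∑ j, {ω | S.arm t ω = j}.indicator f ω * h j (ω t j) := by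
    intro ω
    rw [Finset.sum_eq_single (S.arm t ω)]
    · simp
    · intro j _ hj
      rw [indicator_of_notMem (by simpa using hj.symm), zero_mul]
    · simp
  simp_rw [h1]
  rw [lintegral_finsetSum]
  · refine Finset.sum_congr rfl fun j _ => ?_
    rw [lintegral_mul_obs hm S (hf.indicator (hA j)) (hh j),
      lintegral_indicator (history_le S t _ (hA j))]
  · intro j _
    exact ((hf.indicator (hA j)).mono (history_le S t) le_rfl).mul
      ((hh j).comp (measurable_obs t j))

end Independence

/-! ### Change of measure along the observations -/

section ChangeOfMeasure

variable {K : ℕ} {E : ExpFamily} {μ ν : Fin K → ℝ}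

theorem measurable_obs_arm (S : SamplingRule K) {s t : ℕ} (hst : s < t) {β : Type*}
    [MeasurableSpace β] {φ : Fin K → ℝ → β} (hφ : ∀ j, Measurable (φ j)) :
    Measurable[history S.arm t] fun ω => φ (S.arm s ω) (ω s (S.arm s ω)) := by
  have harm : Measurable[history S.arm t] (S.arm s) :=
    (S.adapted s).mono (history_mono S.arm hst.le) le_rfl
  have hX : Measurable[history S.arm t] fun ω => ω s (S.arm s ω) := by
    rw [measurable_iff_comap_le, (inferInstance : BorelSpace ℝ).measurable_eq]
    exact le_sup_right.trans (le_iSup₂_of_le s hst le_rfl)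
  exact (measurable_from_prod_countable_left (f := fun p : ℝ × Fin K => φ p.2 p.1)
    (fun k => hφ k)).comp (hX.prodMk harm)

/-- The log-likelihood ratio of the observation of slot `t + 1` under the loads `ν` and `μ`. -/
def obsLogRatio (E : ExpFamily) (μ ν : Fin K → ℝ) (S : SamplingRule K) (t : ℕ) (ω : Obs K) : ℝ :=
  E.logRatio (μ (S.arm t ω)) (ν (S.arm t ω)) (ω t (S.arm t ω))

/-- The log-likelihood ratio of the first `t` observations under the loads `ν` and `μ`. -/
def logLik (E : ExpFamily) (μ ν : Fin K → ℝ) (S : SamplingRule K) (t : ℕ) (ω : Obs K) : ℝ :=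
  ∑ s ∈ Finset.range t, obsLogRatio E μ ν S s ω

theorem measurable_obsLogRatio (S : SamplingRule K) {s t : ℕ} (hst : s < t) :
    Measurable[history S.arm t] (obsLogRatio E μ ν S s) :=
  measurable_obs_arm S hst (φ := fun j x => E.logRatio (μ j) (ν j) x) fun _ =>
    ExpFamily.measurable_logRatio _ _

theorem measurable_logLik (S : SamplingRule K) (t : ℕ) :
    Measurable[history S.arm t] (logLik E μ ν S t) :=
  Finset.measurable_sum _ fun _ hs => measurable_obsLogRatio S (Finset.mem_range.1 hs)

/-- The next arm is already determined by the past, so the only new information is the observed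
value. These intersections form a π-system on which the two measures can be compared. -/
theorem history_succ (S : SamplingRule K) (t : ℕ) :
    history S.arm (t + 1) = MeasurableSpace.generateFrom
      {s | ∃ A B, MeasurableSet[history S.arm t] A ∧ MeasurableSet B ∧
        s = A ∩ {ω | ω t (S.arm t ω) ∈ B}} := by
  apply le_antisymm
  · refine iSup₂_le fun s hs => ?_
    rcases (Nat.lt_succ_iff.1 hs).lt_or_eq with hlt | rfl
    · refine le_trans (le_iSup₂_of_le (f := fun s (_ : s ∈ Set.Iio t) =>
        MeasurableSpace.comap (S.arm s) ⊤ ⊔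
          MeasurableSpace.comap (fun ω : Obs K => ω s (S.arm s ω)) (borel ℝ)) s hlt le_rfl) ?_
      intro A hA
      exact MeasurableSpace.measurableSet_generateFrom ⟨A, univ, hA, MeasurableSet.univ, by simp⟩
    · refine sup_le ?_ ?_
      · rintro _ ⟨A, -, rfl⟩
        exact MeasurableSpace.measurableSet_generateFrom
          ⟨S.arm s ⁻¹' A, univ, S.adapted s trivial, MeasurableSet.univ, by simp⟩
      · rintro _ ⟨B, hB, rfl⟩
        rw [← (inferInstance : BorelSpace ℝ).measurable_eq] at hB
        refine MeasurableSpace.measurableSet_generateFrom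
          ⟨univ, B, @MeasurableSet.univ _ (history S.arm s), hB, ?_⟩
        rw [univ_inter]
        rfl
  · refine MeasurableSpace.generateFrom_le ?_
    rintro _ ⟨A, B, hA, hB, rfl⟩
    exact (history_mono S.arm (Nat.le_succ t) _ hA).inter
      (measurable_obs_arm S (Nat.lt_succ_self t) (φ := fun _ x => x) (fun _ => measurable_id) hB)

theorem isPiSystem_history_succ (S : SamplingRule K) (t : ℕ) :
    IsPiSystem {s | ∃ A B, MeasurableSet[history S.arm t] A ∧ MeasurableSet B ∧
        s = A ∩ {ω | ω t (S.arm t ω) ∈ B}} := by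
  rintro _ ⟨A, B, hA, hB, rfl⟩ _ ⟨A', B', hA', hB', rfl⟩ -
  refine ⟨A ∩ A', B ∩ B', hA.inter hA', hB.inter hB', ?_⟩
  ext ω
  simp only [mem_inter_iff, mem_ofPred_eq]
  tauto

/-- Change of measure: on the events of the first `t` observations, the law of the measurements
under `ν` has the density `exp (logLik t)` with respect to that under `μ`. -/
theorem obsLaw_apply_eq_setLIntegral (hm : ∀ i, μ i ∈ E.means) (hn : ∀ i, ν i ∈ E.means)
    (S : SamplingRule K) (t : ℕ) {A : Set (Obs K)} (hA : MeasurableSet[history S.arm t] A) :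
    obsLaw E ν A = ∫⁻ ω in A, ENNReal.ofReal (Real.exp (logLik E μ ν S t ω)) ∂(obsLaw E μ) := by
  have hP := isProbabilityMeasure_obsLaw hm
  have hQ := isProbabilityMeasure_obsLaw hn
  induction t generalizing A with
  | zero =>
    have hbot : history S.arm 0 = ⊥ := by
      simp [history]
    rw [hbot, MeasurableSpace.measurableSet_bot_iff] at hA
    rcases hA with rfl | rfl <;> simp [logLik]
  | succ t ih =>
    set D : ℕ → Obs K → ℝ≥0∞ := fun t ω => ENNReal.ofReal (Real.exp (logLik E μ ν S t ω)) with hD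
    have hDm : ∀ t, Measurable[history S.arm t] (D t) := fun t =>
      (Real.measurable_exp.comp (measurable_logLik S t)).ennreal_ofReal
    -- On a generator, splitting by the chosen arm and using independence separates the past,
    -- covered by induction, from the one-slot density.
    have hgen : ∀ s ∈ {s | ∃ A B, MeasurableSet[history S.arm t] A ∧ MeasurableSet B ∧
        s = A ∩ {ω | ω t (S.arm t ω) ∈ B}},
        obsLaw E ν s = ∫⁻ ω in s, D (t + 1) ω ∂(obsLaw E μ) := by
      rintro _ ⟨A, B, hA, hB, rfl⟩
      have hmeas : MeasurableSet (A ∩ {ω | ω t (S.arm t ω) ∈ B}) := by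
        refine history_le S (t + 1) _ ?_
        rw [history_succ]
        exact MeasurableSpace.measurableSet_generateFrom ⟨A, B, hA, hB, rfl⟩
      have hAm := history_le S t _ hA
      have hB1 : Measurable (B.indicator (1 : ℝ → ℝ≥0∞)) := measurable_one.indicator hB
      have hA1 : Measurable[history S.arm t] (A.indicator (1 : Obs K → ℝ≥0∞)) :=
        Measurable.indicator (@measurable_const _ _ _ (history S.arm t) 1) hA
      have hleft : obsLaw E ν (A ∩ {ω | ω t (S.arm t ω) ∈ B}) =
          ∑ j, obsLaw E ν (A ∩ {ω | S.arm t ω = j}) * E.law (ν j) B := by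
        rw [← lintegral_indicator_one hmeas]
        have := lintegral_mul_obs_arm hn S hA1 (h := fun _ => B.indicator 1) fun _ => hB1
        simp_rw [lintegral_indicator_one hB] at this
        convert this using 3 with ω
        · by_cases h1 : ω ∈ A <;> by_cases h2 : ω t (S.arm t ω) ∈ B <;> simp [h1, h2]
        · rw [setLIntegral_indicator hAm]
          simp
      have hright : ∫⁻ ω in A ∩ {ω | ω t (S.arm t ω) ∈ B}, D (t + 1) ω ∂(obsLaw E μ) =
          ∑ j, (∫⁻ ω in A ∩ {ω | S.arm t ω = j}, D t ω ∂(obsLaw E μ)) *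
            ∫⁻ x in B, ENNReal.ofReal (Real.exp (E.logRatio (μ j) (ν j) x)) ∂(E.law (μ j)) := by
        rw [← lintegral_indicator hmeas]
        have := lintegral_mul_obs_arm hm S ((hDm t).indicator hA) (h := fun j => B.indicator
          fun x => ENNReal.ofReal (Real.exp (E.logRatio (μ j) (ν j) x))) fun j =>
            ((Real.measurable_exp.comp (ExpFamily.measurable_logRatio _ _)).ennreal_ofReal).indicator
              hB
        simp_rw [lintegral_indicator hB] at this
        convert this using 3 with ω
        · by_cases h1 : ω ∈ A <;> by_cases h2 : ω t (S.arm t ω) ∈ B <;> simp [h1, h2]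
          simp only [hD, logLik, Finset.sum_range_succ]
          rw [← ENNReal.ofReal_mul (Real.exp_pos _).le, ← Real.exp_add]
          rfl
        · rw [setLIntegral_indicator hAm]
      rw [hleft, hright]
      refine Finset.sum_congr rfl fun j _ => ?_
      rw [ih (hA.inter (measurableSet_arm_eq S t j)),
        ExpFamily.law_eq_withDensity (hm j) (hn j), withDensity_apply _ hB]
    have hle := history_le S (t + 1)
    have huniv := hgen univ ⟨univ, univ, @MeasurableSet.univ _ (history S.arm t),
      MeasurableSet.univ, by simp⟩
    -- The measures need only agree on the history, so both are trimmed to it before the π-system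
    -- argument.
    have hext : (obsLaw E ν).trim hle = ((obsLaw E μ).withDensity (D (t + 1))).trim hle := by
      refine ext_of_generate_finite _ (history_succ S t) (isPiSystem_history_succ S t) ?_ ?_
      · rintro s hs
        have hsm : MeasurableSet[history S.arm (t + 1)] s := by
          rw [history_succ]
          exact MeasurableSpace.measurableSet_generateFrom hs
        rw [trim_measurableSet_eq hle hsm, trim_measurableSet_eq hle hsm,
          withDensity_apply _ (hle _ hsm), hgen s hs]
      · rw [trim_measurableSet_eq hle MeasurableSet.univ,
          trim_measurableSet_eq hle MeasurableSet.univ, withDensity_apply _ MeasurableSet.univ,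
          huniv]
    rw [← trim_measurableSet_eq hle hA, hext, trim_measurableSet_eq hle hA,
      withDensity_apply _ (hle _ hA)]

end ChangeOfMeasure

/-! ### Likelihood at the stopping time and the transportation inequality -/

section Stopped

variable {K : ℕ} {E : ExpFamily} {μ ν : Fin K → ℝ}

theorem integrable_logRatio_obs (hm : ∀ i, μ i ∈ E.means) (t : ℕ) (j : Fin K) (b : ℝ) :
    Integrable (fun ω : Obs K => E.logRatio (μ j) b (ω t j)) (obsLaw E μ) := by
  have h := ExpFamily.integrable_logRatio (hm j) b
  rw [← map_obs_obsLaw hm t j] at h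
  exact h.comp_measurable (measurable_obs t j)

theorem integral_logRatio_obs (hm : ∀ i, μ i ∈ E.means) (t : ℕ) (j : Fin K) {b : ℝ}
    (hb : b ∈ E.means) : ∫ ω, E.logRatio (μ j) b (ω t j) ∂(obsLaw E μ) = -E.d (μ j) b := by
  rw [← ExpFamily.integral_logRatio (hm j) hb, ← map_obs_obsLaw hm t j,
    integral_map (measurable_obs t j).aemeasurable
      (ExpFamily.measurable_logRatio _ _).aestronglyMeasurable]

theorem indepFun_indicator_logRatio (hm : ∀ i, μ i ∈ E.means) (S : SamplingRule K) {t : ℕ}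
    {A : Set (Obs K)} (hA : MeasurableSet[history S.arm t] A) (j : Fin K) (b : ℝ) :
    IndepFun (A.indicator fun _ => (1 : ℝ)) (fun ω => E.logRatio (μ j) b (ω t j))
      (obsLaw E μ) := by
  rw [IndepFun_iff_Indep]
  refine indep_of_indep_of_le_left (indep_of_indep_of_le_right
    (indep_history_slotSpace hm S t) ?_) ?_
  · exact ((ExpFamily.measurable_logRatio _ _).comp (measurable_slotSpace_obs t j)).comap_le
  · exact (Measurable.indicator (@measurable_const _ _ _ (history S.arm t) 1) hA).comap_le

theorem indicator_obsLogRatio_eq_sum (S : SamplingRule K) (t : ℕ) (A : Set (Obs K)) (ω : Obs K) :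
    A.indicator (obsLogRatio E μ ν S t) ω =
      ∑ j, (A ∩ {ω | S.arm t ω = j}).indicator (fun _ => (1 : ℝ)) ω *
        E.logRatio (μ j) (ν j) (ω t j) := by
  rw [Finset.sum_eq_single (S.arm t ω)]
  · by_cases h : ω ∈ A <;> simp [h, obsLogRatio]
  · intro j _ hj
    rw [indicator_of_notMem (fun h => hj h.2.symm), zero_mul]
  · simp

theorem integrable_indicator_obsLogRatio (hm : ∀ i, μ i ∈ E.means) (S : SamplingRule K) {t : ℕ}
    {A : Set (Obs K)} (hA : MeasurableSet[history S.arm t] A) :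
    Integrable (A.indicator (obsLogRatio E μ ν S t)) (obsLaw E μ) := by
  have := isProbabilityMeasure_obsLaw hm
  simp_rw [funext (indicator_obsLogRatio_eq_sum (E := E) (μ := μ) (ν := ν) S t A)]
  refine integrable_finsetSum _ fun j _ => ?_
  have hAj := hA.inter (measurableSet_arm_eq S t j)
  exact (indepFun_indicator_logRatio hm S hAj j (ν j)).integrable_mul
    ((integrable_const 1).indicator (history_le S t _ hAj)) (integrable_logRatio_obs hm t j (ν j))

/-- Whether `A` occurs and which arm is drawn is decided before the value is seen, so each
expectation factors. -/
theorem integral_indicator_obsLogRatio (hm : ∀ i, μ i ∈ E.means) (hn : ∀ i, ν i ∈ E.means)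
    (S : SamplingRule K) {t : ℕ} {A : Set (Obs K)} (hA : MeasurableSet[history S.arm t] A) :
    ∫ ω, A.indicator (obsLogRatio E μ ν S t) ω ∂(obsLaw E μ) =
      -∑ j, (obsLaw E μ).real (A ∩ {ω | S.arm t ω = j}) * E.d (μ j) (ν j) := by
  have := isProbabilityMeasure_obsLaw hm
  simp_rw [indicator_obsLogRatio_eq_sum (E := E) (μ := μ) (ν := ν) S t A]
  rw [integral_finsetSum, ← Finset.sum_neg_distrib]
  · refine Finset.sum_congr rfl fun j _ => ?_
    have hAj := hA.inter (measurableSet_arm_eq S t j)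
    have hAj' := history_le S t _ hAj
    rw [(indepFun_indicator_logRatio hm S hAj j (ν j)).integral_fun_mul_eq_mul_integral
      ((aestronglyMeasurable_const).indicator hAj')
      (integrable_logRatio_obs hm t j (ν j)).aestronglyMeasurable,
      integral_logRatio_obs hm t j (hn j), integral_indicator_const _ hAj']
    simp
  · intro j _
    have hAj := hA.inter (measurableSet_arm_eq S t j)
    exact (indepFun_indicator_logRatio hm S hAj j (ν j)).integrable_mul
      ((integrable_const 1).indicator (history_le S t _ hAj)) (integrable_logRatio_obs hm t j (ν j))

/-- The log-likelihood ratio of the observations up to the stopping time or slot `n`. -/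
def stoppedLogLik (E : ExpFamily) (μ ν : Fin K → ℝ) (A : Algorithm K) (n : ℕ) (ω : Obs K) : ℝ :=
  ∑ s ∈ Finset.range n,
    {ω | (s : ℕ∞) < A.τ ω}.indicator (obsLogRatio E μ ν A.toSamplingRule s) ω

/-- The expected number of measurements of slice `j` in the first `n` slots before stopping. -/
def expectedCount (E : ExpFamily) (μ : Fin K → ℝ) (A : Algorithm K) (n : ℕ) (j : Fin K) : ℝ :=
  ∑ s ∈ Finset.range n, (obsLaw E μ).real ({ω | (s : ℕ∞) < A.τ ω} ∩ {ω | A.arm s ω = j})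

theorem measurableSet_lt_stop (A : Algorithm K) (s : ℕ) :
    MeasurableSet[history A.arm s] {ω | (s : ℕ∞) < A.τ ω} :=
  A.isStoppingTime.measurableSet_gt s

theorem measurableSet_eq_stop (A : Algorithm K) (s : ℕ) :
    MeasurableSet[history A.arm s] {ω | A.τ ω = (s : ℕ∞)} :=
  A.isStoppingTime.measurableSet_eq s

theorem integrable_stoppedLogLik (hm : ∀ i, μ i ∈ E.means) (A : Algorithm K) (n : ℕ) :
    Integrable (stoppedLogLik E μ ν A n) (obsLaw E μ) :=
  integrable_finsetSum _ fun s _ =>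
    integrable_indicator_obsLogRatio hm A.toSamplingRule (measurableSet_lt_stop A s)

/-- Wald's identity for $\min(\tau,n)$, obtained slot by slot because $\{s<\tau\}$ belongs to the
history of the first $s$ slots. -/
theorem integral_stoppedLogLik (hm : ∀ i, μ i ∈ E.means) (hn : ∀ i, ν i ∈ E.means)
    (A : Algorithm K) (n : ℕ) :
    ∫ ω, stoppedLogLik E μ ν A n ω ∂(obsLaw E μ) =
      -∑ j, expectedCount E μ A n j * E.d (μ j) (ν j) := by
  unfold stoppedLogLik expectedCount
  rw [integral_finsetSum _ fun s _ =>
    integrable_indicator_obsLogRatio hm A.toSamplingRule (measurableSet_lt_stop A s)]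
  simp_rw [Finset.sum_mul]
  rw [Finset.sum_comm, ← Finset.sum_neg_distrib]
  exact Finset.sum_congr rfl fun s _ =>
    integral_indicator_obsLogRatio hm hn A.toSamplingRule (measurableSet_lt_stop A s)

/-- The hypothesis `h` expresses $\min(\tau,n)=s$ at `ω`. -/
theorem stoppedLogLik_eq_logLik {A : Algorithm K} {n s : ℕ} (hs : s ≤ n) {ω : Obs K}
    (h : ∀ i < n, (i : ℕ∞) < A.τ ω ↔ i < s) :
    stoppedLogLik E μ ν A n ω = logLik E μ ν A.toSamplingRule s ω := by
  unfold stoppedLogLik logLik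
  rw [← Finset.sum_subset (Finset.range_mono hs)]
  · refine Finset.sum_congr rfl fun i hi => ?_
    have hi' := Finset.mem_range.1 hi
    exact indicator_of_mem (s := {ω | (i : ℕ∞) < A.τ ω}) ((h i (hi'.trans_le hs)).2 hi')
      (obsLogRatio E μ ν A.toSamplingRule i)
  · intro i hi hi'
    apply indicator_of_notMem
    exact fun hlt => hi' (Finset.mem_range.2 ((h i (Finset.mem_range.1 hi)).1 hlt))

theorem setLIntegral_exp_stoppedLogLik (hm : ∀ i, μ i ∈ E.means) (hn : ∀ i, ν i ∈ E.means)
    (A : Algorithm K) {n s : ℕ} (hs : s ≤ n) {B : Set (Obs K)}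
    (hB : MeasurableSet[history A.arm s] B) (h : ∀ ω ∈ B, ∀ i < n, (i : ℕ∞) < A.τ ω ↔ i < s) :
    ∫⁻ ω in B, ENNReal.ofReal (Real.exp (stoppedLogLik E μ ν A n ω)) ∂(obsLaw E μ) =
      obsLaw E ν B := by
  rw [obsLaw_apply_eq_setLIntegral hm hn A.toSamplingRule s hB]
  refine setLIntegral_congr_fun (history_le A.toSamplingRule s _ hB) fun ω hω => ?_
  simp only [stoppedLogLik_eq_logLik hs (h ω hω)]

theorem inter_lt_stop_eq_iUnion (A : Algorithm K) (D : Set (Obs K)) (n : ℕ) :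
    D ∩ {ω | A.τ ω < (n : ℕ∞)} = ⋃ s ∈ Finset.range n, D ∩ {ω | A.τ ω = (s : ℕ∞)} := by
  ext ω
  simp only [mem_inter_iff, mem_ofPred_eq, mem_iUnion, Finset.mem_range, exists_prop]
  constructor
  · rintro ⟨h1, h2⟩
    obtain ⟨m, hm⟩ := ENat.ne_top_iff_exists.1 h2.ne_top
    exact ⟨m, by rw [← hm] at h2; exact_mod_cast h2, h1, hm.symm⟩
  · rintro ⟨s, hs, h1, h2⟩
    exact ⟨h1, by rw [h2]; exact_mod_cast hs⟩

theorem setLIntegral_exp_stoppedLogLik_inter_lt (hm : ∀ i, μ i ∈ E.means)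
    (hn : ∀ i, ν i ∈ E.means) (A : Algorithm K) {D : Set (Obs K)}
    (hD : ∀ s : ℕ, MeasurableSet[history A.arm s] (D ∩ {ω | A.τ ω = (s : ℕ∞)})) (n : ℕ) :
    ∫⁻ ω in D ∩ {ω | A.τ ω < (n : ℕ∞)},
        ENNReal.ofReal (Real.exp (stoppedLogLik E μ ν A n ω)) ∂(obsLaw E μ) =
      obsLaw E ν (D ∩ {ω | A.τ ω < (n : ℕ∞)}) := by
  have hmeas : ∀ s : ℕ, MeasurableSet (D ∩ {ω | A.τ ω = (s : ℕ∞)}) := fun s =>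
    history_le A.toSamplingRule s _ (hD s)
  have hdisj : Set.PairwiseDisjoint (↑(Finset.range n)) fun s : ℕ =>
      D ∩ {ω | A.τ ω = (s : ℕ∞)} := by
    intro s _ t _ hst
    refine Set.disjoint_left.2 fun ω h1 h2 => hst ?_
    have : (s : ℕ∞) = t := h1.2.symm.trans h2.2
    exact_mod_cast this
  rw [inter_lt_stop_eq_iUnion, lintegral_biUnion_finset hdisj fun s _ => hmeas s,
    measure_biUnion_finset hdisj fun s _ => hmeas s]
  refine Finset.sum_congr rfl fun s hs => ?_
  refine setLIntegral_exp_stoppedLogLik hm hn A (Finset.mem_range.1 hs).le (hD s) ?_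
  intro ω hω i _
  rw [show A.τ ω = s from hω.2]
  exact_mod_cast Iff.rfl

theorem measurableSet_inter_lt_stop (A : Algorithm K) {D : Set (Obs K)}
    (hD : ∀ s : ℕ, MeasurableSet[history A.arm s] (D ∩ {ω | A.τ ω = (s : ℕ∞)})) (n : ℕ) :
    MeasurableSet (D ∩ {ω | A.τ ω < (n : ℕ∞)}) := by
  rw [inter_lt_stop_eq_iUnion]
  exact Finset.measurableSet_biUnion _ fun s _ => history_le A.toSamplingRule s _ (hD s)

/-- On each event $\{\tau=s\}$ with $s<n$, and on $\{\tau\ge n\}$, the stopped likelihood is an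
ordinary one at a fixed time; the pieces add up to the total mass under `ν`. -/
theorem lintegral_exp_stoppedLogLik (hm : ∀ i, μ i ∈ E.means) (hn : ∀ i, ν i ∈ E.means)
    (A : Algorithm K) (n : ℕ) :
    ∫⁻ ω, ENNReal.ofReal (Real.exp (stoppedLogLik E μ ν A n ω)) ∂(obsLaw E μ) = 1 := by
  have := isProbabilityMeasure_obsLaw hn
  have hD : ∀ s : ℕ, MeasurableSet[history A.arm s] (univ ∩ {ω | A.τ ω = (s : ℕ∞)}) := by
    intro s
    rw [univ_inter]
    exact measurableSet_eq_stop A s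
  have hlt := measurableSet_inter_lt_stop A hD n
  have h1 := setLIntegral_exp_stoppedLogLik_inter_lt hm hn A hD n
  rw [univ_inter] at hlt h1
  have hc : {ω | A.τ ω < (n : ℕ∞)}ᶜ = {ω | (n : ℕ∞) ≤ A.τ ω} := by
    ext ω
    simp
  have h2 := setLIntegral_exp_stoppedLogLik hm hn A (n := n) (s := n) le_rfl
    (A.isStoppingTime.measurableSet_ge n) fun ω hω i hi =>
      have hi' : (i : ℕ∞) < (n : ℕ∞) := by exact_mod_cast hi
      iff_of_true (hi'.trans_le hω) hi
  rw [← lintegral_add_compl _ hlt, h1, hc]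
  refine (congrArg _ h2).trans ?_
  have h3 := prob_add_prob_compl (μ := obsLaw E ν) hlt
  rw [hc] at h3
  exact h3

theorem measurable_stoppedLogLik (A : Algorithm K) (n : ℕ) :
    Measurable (stoppedLogLik E μ ν A n) :=
  Finset.measurable_sum _ fun s _ =>
    ((measurable_obsLogRatio A.toSamplingRule (Nat.lt_succ_self s)).mono
      (history_le A.toSamplingRule (s + 1)) le_rfl).indicator
      (history_le A.toSamplingRule s _ (measurableSet_lt_stop A s))

theorem integrable_exp_stoppedLogLik (hm : ∀ i, μ i ∈ E.means) (hn : ∀ i, ν i ∈ E.means)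
    (A : Algorithm K) (n : ℕ) :
    Integrable (fun ω => Real.exp (stoppedLogLik E μ ν A n ω)) (obsLaw E μ) := by
  refine ⟨(Real.measurable_exp.comp (measurable_stoppedLogLik A n)).aestronglyMeasurable, ?_⟩
  rw [hasFiniteIntegral_iff_ofReal (Filter.Eventually.of_forall fun _ => (Real.exp_pos _).le),
    lintegral_exp_stoppedLogLik hm hn]
  exact ENNReal.one_lt_top

theorem integral_exp_stoppedLogLik (hm : ∀ i, μ i ∈ E.means) (hn : ∀ i, ν i ∈ E.means)
    (A : Algorithm K) (n : ℕ) :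
    ∫ ω, Real.exp (stoppedLogLik E μ ν A n ω) ∂(obsLaw E μ) = 1 := by
  rw [integral_eq_lintegral_of_nonneg_ae (Filter.Eventually.of_forall fun _ => (Real.exp_pos _).le)
    (integrable_exp_stoppedLogLik hm hn A n).aestronglyMeasurable,
    lintegral_exp_stoppedLogLik hm hn, ENNReal.toReal_one]

theorem setIntegral_exp_stoppedLogLik (hm : ∀ i, μ i ∈ E.means) (hn : ∀ i, ν i ∈ E.means)
    (A : Algorithm K) {D : Set (Obs K)}
    (hD : ∀ s : ℕ, MeasurableSet[history A.arm s] (D ∩ {ω | A.τ ω = (s : ℕ∞)})) (n : ℕ) :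
    ∫ ω in D ∩ {ω | A.τ ω < (n : ℕ∞)},
        Real.exp (stoppedLogLik E μ ν A n ω) ∂(obsLaw E μ) =
      (obsLaw E ν).real (D ∩ {ω | A.τ ω < (n : ℕ∞)}) := by
  rw [integral_eq_lintegral_of_nonneg_ae (Filter.Eventually.of_forall fun _ => (Real.exp_pos _).le)
    (integrable_exp_stoppedLogLik hm hn A n).aestronglyMeasurable.restrict,
    setLIntegral_exp_stoppedLogLik_inter_lt hm hn A hD, Measure.real]

/-- The transportation inequality for the event `D` decided before slot `n`, in a form that is
linear in the probability of `D` under the reference loads. -/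
theorem log_mul_le_sum_expectedCount (hm : ∀ i, μ i ∈ E.means) (hn : ∀ i, ν i ∈ E.means)
    (A : Algorithm K) {D : Set (Obs K)}
    (hD : ∀ s : ℕ, MeasurableSet[history A.arm s] (D ∩ {ω | A.τ ω = (s : ℕ∞)})) (n : ℕ) {δ : ℝ}
    (hδ : 0 < δ) (hδ2 : δ ≤ 1 / 2) (hq : (obsLaw E ν).real D ≤ δ) :
    Real.log ((1 - δ) / δ) * (2 * (obsLaw E μ).real (D ∩ {ω | A.τ ω < (n : ℕ∞)}) - 1) ≤
      ∑ j, expectedCount E μ A n j * E.d (μ j) (ν j) := by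
  have hP := isProbabilityMeasure_obsLaw hm
  have hQ := isProbabilityMeasure_obsLaw hn
  set B := D ∩ {ω | A.τ ω < (n : ℕ∞)} with hBdef
  set M := stoppedLogLik E μ ν A n with hM
  set ρ := (1 - δ) / δ with hρ
  have hBm : MeasurableSet B := measurableSet_inter_lt_stop A hD n
  have hρ1 : 1 ≤ ρ := by
    rw [hρ, le_div_iff₀ hδ]
    linarith
  have hρ0 : 0 < ρ := by linarith
  have hMi : Integrable M (obsLaw E μ) := integrable_stoppedLogLik hm A n
  have hEi : Integrable (fun ω => Real.exp (M ω)) (obsLaw E μ) :=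
    integrable_exp_stoppedLogLik hm hn A n
  have hEB := setIntegral_exp_stoppedLogLik hm hn A hD n
  rw [← hBdef, ← hM] at hEB
  have hE1 := integral_exp_stoppedLogLik hm hn A n
  rw [← hM] at hE1
  have hMint := integral_stoppedLogLik hm hn A n
  rw [← hM] at hMint
  -- Tangent lines of `exp` at $-\log\rho$ on `B` and at $\log\rho$ off `B`, the log-ratios in the
  -- extremal case where `B` has probability $1-\delta$ under `μ` and $\delta$ under `ν`.
  have hpt : ∀ ω, M ω ≤ ρ⁻¹ * Real.exp (M ω) + (ρ - ρ⁻¹) * B.indicator (fun ω => Real.exp (M ω)) ω +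
      (Real.log ρ - 1) - 2 * Real.log ρ * B.indicator (fun _ => (1 : ℝ)) ω := by
    intro ω
    by_cases h : ω ∈ B
    · have := Real.add_one_le_exp (M ω + Real.log ρ)
      rw [Real.exp_add, Real.exp_log hρ0] at this
      simp only [indicator_of_mem h]
      linarith
    · have := Real.add_one_le_exp (M ω - Real.log ρ)
      rw [Real.exp_sub, Real.exp_log hρ0, div_eq_inv_mul] at this
      simp only [indicator_of_notMem h]
      linarith
  have hI1 : Integrable (B.indicator fun ω => Real.exp (M ω)) (obsLaw E μ) := hEi.indicator hBm
  have hI2 : Integrable (B.indicator fun _ => (1 : ℝ)) (obsLaw E μ) :=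
    (integrable_const 1).indicator hBm
  have hJ1 : Integrable (fun ω => ρ⁻¹ * Real.exp (M ω)) (obsLaw E μ) := hEi.const_mul _
  have hJ2 : Integrable (fun ω => (ρ - ρ⁻¹) * B.indicator (fun ω => Real.exp (M ω)) ω)
    (obsLaw E μ) := hI1.const_mul _
  have hJ12 : Integrable (fun ω => ρ⁻¹ * Real.exp (M ω) +
    (ρ - ρ⁻¹) * B.indicator (fun ω => Real.exp (M ω)) ω) (obsLaw E μ) := hJ1.add hJ2
  have hJ3 : Integrable (fun ω => ρ⁻¹ * Real.exp (M ω) +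
    (ρ - ρ⁻¹) * B.indicator (fun ω => Real.exp (M ω)) ω + (Real.log ρ - 1)) (obsLaw E μ) :=
    hJ12.add (integrable_const _)
  have hJ4 : Integrable (fun ω => 2 * Real.log ρ * B.indicator (fun _ => (1 : ℝ)) ω)
    (obsLaw E μ) := hI2.const_mul _
  have hint := integral_mono hMi (hJ3.sub hJ4) hpt
  simp only [Pi.sub_apply] at hint
  rw [integral_sub hJ3 hJ4, integral_add hJ12 (integrable_const _), integral_add hJ1 hJ2,
    integral_const_mul,
    integral_const_mul, integral_const_mul, hE1, integral_indicator hBm, hEB,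
    integral_indicator_const _ hBm, integral_const, hMint] at hint
  simp only [smul_eq_mul, mul_one, probReal_univ, one_mul] at hint
  have hqB : (obsLaw E ν).real B ≤ δ := (measureReal_mono inter_subset_left).trans hq
  have hρρ : 0 ≤ ρ - ρ⁻¹ := by
    have := inv_le_one_of_one_le₀ hρ1
    linarith
  have hmul := mul_le_mul_of_nonneg_left hqB hρρ
  -- With $\rho=(1-\delta)/\delta$ the exponential terms total at most `1`, which cancels the
  -- constant `-1` of the tangent lines.
  have hid : ρ⁻¹ + (ρ - ρ⁻¹) * δ = 1 := by
    have h1 : 1 - δ ≠ 0 := by linarith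
    rw [hρ]
    field_simp
    ring
  linarith

end Stopped

/-! ### The lower bound on the expected stopping time -/

section LowerBound

open Filter Topology

variable {K : ℕ} {E : ExpFamily} {γ : ℝ} {μ : Fin K → ℝ} {k : Fin K}

theorem dB_one_sub (δ : ℝ) : dB δ (1 - δ) = (1 - 2 * δ) * Real.log ((1 - δ) / δ) := by
  have h : Real.log (δ / (1 - δ)) = -Real.log ((1 - δ) / δ) := by
    rw [← Real.log_inv, inv_div]
  rw [dB, sub_sub_cancel, h]
  ring

/-- The right-hand side is $\mathbb E_\mu[\min(\tau,n)]$ as a sum of tail probabilities. -/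
theorem sum_expectedCount (hm : ∀ i, μ i ∈ E.means) (A : Algorithm K) (n : ℕ) :
    ∑ j, expectedCount E μ A n j =
      ∑ s ∈ Finset.range n, (obsLaw E μ).real {ω | (s : ℕ∞) < A.τ ω} := by
  have := isProbabilityMeasure_obsLaw hm
  unfold expectedCount
  rw [Finset.sum_comm]
  refine Finset.sum_congr rfl fun s _ => ?_
  rw [← measureReal_biUnion_finset]
  · congr 1
    ext ω
    simp
  · intro i _ j _ hij
    exact Set.disjoint_left.2 fun ω h1 h2 => hij (h1.2.symm.trans h2.2)
  · exact fun j _ => history_le A.toSamplingRule s _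
      ((measurableSet_lt_stop A s).inter (measurableSet_arm_eq A.toSamplingRule s j))

theorem sum_indicator_lt_le (n : ℕ) (t : ℕ∞) :
    ∑ s ∈ Finset.range n, (if (s : ℕ∞) < t then (1 : ℝ≥0∞) else 0) ≤ (t : ℝ≥0∞) := by
  rcases eq_or_ne t ⊤ with rfl | ht
  · simp
  · obtain ⟨m, rfl⟩ := ENat.ne_top_iff_exists.1 ht
    rw [Finset.sum_ite, Finset.sum_const_zero, add_zero, Finset.sum_const, nsmul_eq_mul, mul_one,
      ENat.toENNReal_coe]
    have : ((Finset.range n).filter fun s : ℕ => (s : ℕ∞) < (m : ℕ∞)).card ≤ m := by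
      refine (Finset.card_le_card (t := Finset.range m) fun s hs => ?_).trans_eq
        (Finset.card_range m)
      have := (Finset.mem_filter.1 hs).2
      exact Finset.mem_range.2 (by exact_mod_cast this)
    exact_mod_cast this

theorem ofReal_sum_expectedCount_le (hm : ∀ i, μ i ∈ E.means) (A : Algorithm K) (n : ℕ) :
    ENNReal.ofReal (∑ j, expectedCount E μ A n j) ≤ A.expectedTime E μ := by
  have := isProbabilityMeasure_obsLaw hm
  have hmeas : ∀ s : ℕ, MeasurableSet {ω | (s : ℕ∞) < A.τ ω} := fun s =>
    history_le A.toSamplingRule s _ (measurableSet_lt_stop A s)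
  rw [sum_expectedCount hm, ENNReal.ofReal_sum_of_nonneg fun _ _ => measureReal_nonneg]
  calc ∑ s ∈ Finset.range n, ENNReal.ofReal ((obsLaw E μ).real {ω | (s : ℕ∞) < A.τ ω})
      = ∑ s ∈ Finset.range n,
          ∫⁻ ω, {ω | (s : ℕ∞) < A.τ ω}.indicator (1 : Obs K → ℝ≥0∞) ω ∂(obsLaw E μ) :=
        Finset.sum_congr rfl fun s _ => by
          rw [lintegral_indicator_one (hmeas s), ofReal_measureReal]
    _ = ∫⁻ ω, ∑ s ∈ Finset.range n,
          {ω | (s : ℕ∞) < A.τ ω}.indicator (1 : Obs K → ℝ≥0∞) ω ∂(obsLaw E μ) :=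
        (lintegral_finsetSum _ fun s _ => measurable_one.indicator (hmeas s)).symm
    _ ≤ A.expectedTime E μ := by
        refine lintegral_mono fun ω => ?_
        refine le_trans (le_of_eq ?_) (sum_indicator_lt_le n (A.τ ω))
        refine Finset.sum_congr rfl fun s _ => ?_
        simp [indicator_apply]

theorem measurableSet_decision_inter (A : Algorithm K) (a : Fin (K + 1)) (s : ℕ) :
    MeasurableSet[history A.arm s] ({ω | A.decision ω = a} ∩ {ω | A.τ ω = (s : ℕ∞)}) := by
  have h : MeasurableSet[A.isStoppingTime.measurableSpace] {ω | A.decision ω = a} :=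
    A.measurable_decision (t := {a}) trivial
  exact (A.isStoppingTime.measurableSet_inter_eq_iff _ s).1
    (h.inter (A.isStoppingTime.measurableSet_eq' s))

theorem correct_eq_singleton (hμ : μ ∈ instances E γ) (hk : IsPackingSlice γ μ k) :
    correct γ μ = {k.succ} := by
  ext a
  constructor
  · rintro (⟨-, h⟩ | ⟨i, rfl, hi⟩)
    · exact absurd hk.1 (not_lt.2 (h k))
    · rw [mem_singleton_iff, hμ.2.2 i k hi hk]
  · rintro rfl
    exact succ_mem_correct.2 hk

theorem measurableSet_decision (A : Algorithm K) (a : Fin (K + 1)) :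
    MeasurableSet {ω | A.decision ω = a} :=
  A.isStoppingTime.measurableSpace_le _ (A.measurable_decision (t := {a}) trivial)

theorem le_measureReal_decision (hμ : μ ∈ instances E γ) (hk : IsPackingSlice γ μ k) {δ : ℝ}
    (hδ : 0 < δ) {A : Algorithm K} (hA : A.IsPC E γ δ) :
    1 - δ ≤ (obsLaw E μ).real {ω | A.decision ω = k.succ} := by
  have := isProbabilityMeasure_obsLaw hμ.1
  have h := (hA μ hμ).2
  have hc : {ω | A.decision ω ∉ correct γ μ} = {ω | A.decision ω = k.succ}ᶜ := by
    ext ω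
    simp [correct_eq_singleton hμ hk]
  rw [hc] at h
  have h2 : (obsLaw E μ).real {ω | A.decision ω = k.succ}ᶜ ≤ δ :=
    ENNReal.toReal_le_of_le_ofReal hδ.le h
  rw [probReal_compl_eq_one_sub (measurableSet_decision A _)] at h2
  linarith

theorem tendsto_measureReal_decision (hμ : μ ∈ instances E γ) {δ : ℝ}
    {A : Algorithm K} (hA : A.IsPC E γ δ) (a : Fin (K + 1)) :
    Tendsto (fun n : ℕ => (obsLaw E μ).real ({ω | A.decision ω = a} ∩ {ω | A.τ ω < (n : ℕ∞)}))
      atTop (𝓝 ((obsLaw E μ).real {ω | A.decision ω = a})) := by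
  have := isProbabilityMeasure_obsLaw hμ.1
  have hmono : Monotone fun n : ℕ => {ω | A.decision ω = a} ∩ {ω | A.τ ω < (n : ℕ∞)} := by
    intro m n hmn
    have hmn' : (m : ℕ∞) ≤ (n : ℕ∞) := by exact_mod_cast hmn
    exact inter_subset_inter_right _ fun ω (hω : A.τ ω < m) => hω.trans_le hmn'
  have h1 := tendsto_measure_iUnion_atTop (μ := obsLaw E μ) hmono
  have h2 : obsLaw E μ (⋃ n : ℕ, {ω | A.decision ω = a} ∩ {ω | A.τ ω < (n : ℕ∞)}) =
      obsLaw E μ {ω | A.decision ω = a} := by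
    refine measure_congr ?_
    filter_upwards [(hA μ hμ).1] with ω hω
    refine propext ⟨fun h => ?_, fun h => ?_⟩
    · obtain ⟨n, hn⟩ := mem_iUnion.1 h
      exact hn.1
    · obtain ⟨m, hm⟩ := ENat.ne_top_iff_exists.1 hω.ne
      refine mem_iUnion.2 ⟨m + 1, h, ?_⟩
      change A.τ ω < ((m + 1 : ℕ) : ℕ∞)
      rw [← hm]
      exact_mod_cast Nat.lt_succ_self m
  rw [h2] at h1
  exact (ENNReal.tendsto_toReal (measure_ne_top _ _)).comp h1

theorem T2_mul_dB_le_expectedTime (hγ : γ ∈ E.means) (hμ : μ ∈ instances E γ)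
    (hk : IsPackingSlice γ μ k) {δ : ℝ} (hδ : 0 < δ) (hδ2 : δ ≤ 1 / 2) {A : Algorithm K}
    (hA : A.IsPC E γ δ) :
    ENNReal.ofReal (T2 E γ μ k * dB δ (1 - δ)) ≤ A.expectedTime E μ := by
  have hT := T2_pos hγ hμ hk
  have hlog : 0 ≤ Real.log ((1 - δ) / δ) := by
    refine Real.log_nonneg ?_
    rw [le_div_iff₀ hδ]
    linarith
  set D := {ω | A.decision ω = k.succ}
  have hbound : ∀ n : ℕ, ENNReal.ofReal (T2 E γ μ k * (Real.log ((1 - δ) / δ) *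
      (2 * (obsLaw E μ).real (D ∩ {ω | A.τ ω < (n : ℕ∞)}) - 1))) ≤ A.expectedTime E μ := by
    intro n
    refine le_trans (ENNReal.ofReal_le_ofReal ?_) (ofReal_sum_expectedCount_le hμ.1 A n)
    -- Weak duality needs no normalization, so the expected counts can serve as weights. Under every
    -- alternative the answer `k.succ` is wrong, hence has probability at most `δ`.
    refine T2_mul_le_sum hγ hμ hk fun ν hν => ?_
    have hνi := (mem_alt_succ.1 hν).1
    have := isProbabilityMeasure_obsLaw hνi.1
    refine log_mul_le_sum_expectedCount hμ.1 hνi.1 A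
      (measurableSet_decision_inter A k.succ) n hδ hδ2 ?_
    refine ENNReal.toReal_le_of_le_ofReal hδ.le (le_trans (measure_mono ?_) (hA ν hνi).2)
    intro ω hω
    rw [mem_ofPred_eq] at hω
    rw [mem_ofPred_eq, hω]
    exact hν.2
  -- Almost sure finiteness of $\tau$ under `μ` makes the truncation disappear in the limit.
  have hlim : Tendsto (fun n : ℕ => ENNReal.ofReal (T2 E γ μ k * (Real.log ((1 - δ) / δ) *
      (2 * (obsLaw E μ).real (D ∩ {ω | A.τ ω < (n : ℕ∞)}) - 1)))) atTop
      (𝓝 (ENNReal.ofReal (T2 E γ μ k * (Real.log ((1 - δ) / δ) *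
        (2 * (obsLaw E μ).real D - 1))))) :=
    ENNReal.tendsto_ofReal ((((tendsto_measureReal_decision hμ hA k.succ).const_mul 2).sub_const
      1).const_mul _ |>.const_mul _)
  refine le_trans (ENNReal.ofReal_le_ofReal ?_) (le_of_tendsto' hlim hbound)
  have hp := le_measureReal_decision hμ hk hδ hA
  rw [dB_one_sub, mul_comm (1 - 2 * δ)]
  exact mul_le_mul_of_nonneg_left (mul_le_mul_of_nonneg_left (by linarith) hlog) hT.le

end LowerBound

end Slicing

end

theorem proposition3 {K : ℕ} (E : Slicing.ExpFamily) (γ : ℝ) (hγ : γ ∈ E.means)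
    (μ : Fin K → ℝ) (hμ : μ ∈ Slicing.instances E γ)
    (k : Fin K) (hk : Slicing.IsPackingSlice γ μ k) :
    -- `y*` and `z*` are well defined
    ((Slicing.lessLoaded μ k).Nonempty → ∃! y : ℝ, Slicing.IsEquilibrium E μ k y) ∧
    0 < Slicing.zStar E γ μ k ∧
    (∀ j ∈ Slicing.lessLoaded μ k, Slicing.zStar E γ μ k ∈ Slicing.gRange E μ j k) ∧
    -- the lower bound on the expected number of measurements
    (∀ δ : ℝ, 0 < δ → δ ≤ 1 / 2 → ∀ A : Slicing.Algorithm K, A.IsPC E γ δ →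
      ENNReal.ofReal (Slicing.T2 E γ μ k * Slicing.dB δ (1 - δ)) ≤ A.expectedTime E μ) ∧
    -- the proportions `w*` are the unique optimal ones, and the optimal rate is `1 / T₂(μ)`
    {w : Fin K → ℝ | w ∈ stdSimplex ℝ (Fin K) ∧
      IsMaxOn (Slicing.rate E γ μ k.succ) (stdSimplex ℝ (Fin K)) w} =
        {Slicing.wStar E γ μ k} ∧
    Slicing.rate E γ μ k.succ (Slicing.wStar E γ μ k) = (Slicing.T2 E γ μ k)⁻¹ := by
  refine ⟨Slicing.existsUnique_isEquilibrium hμ.1, Slicing.zStar_pos hγ hμ.1 hk.1,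
    fun j hj => Slicing.zStar_mem_gRange hγ hμ.1 hk.1 hj,
    fun δ hδ hδ2 A hA => Slicing.T2_mul_dB_le_expectedTime hγ hμ hk hδ hδ2 hA,
    Slicing.setOf_isMaxOn_rate hγ hμ hk, Slicing.rate_wStar hγ hμ hk⟩
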